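/- Let $n\ge 0$ and let $S_n$ be the symmetric group on $\{1,\dots,n\}$, with length function $\ell$ (number of inversions) and Bruhat order $\le$. For $w\in S_n$ and $(i,j)\in\{0,\dots,n\}^2$ put $\mathrm{rk}_w(i,j)=\#\{u=1,\dots,i : w(u)\le j\}$, and for $p=(i,j)$, $p'=(i',j')$ in $\{0,\dots,n\}^2$ put $$\Delta_w(p,p')=\mathrm{rk}_w(i,j)+\mathrm{rk}_w(i',j')-\mathrm{rk}_w(i,j')-\mathrm{rk}_w(i',j).$$ Let $\pi=(w,x)\in S_n\times S_n$ with $x\le w$. Put $\mathrm{rk}_\pi=\mathrm{rk}_x-\mathrm{rk}_w$ (which is $\ge 0$) and $X_\pi=\{p\in\{0,\dots,n\}^2 : \mathrm{rk}_\pi(p)=0\}$. Call $\pi$ *smooth* if the number of transpositions $t\in S_n$ such that $x<xt\le w$ equals $\ell(w)-\ell(x)$. For $p=(i,j)$ with $0\le i\le n$ and $1\le j\le n-1$ define $\mathrm{next}^{\downarrow}(p)=(i',j)$, where $$i'=\max\{l\ge i : (l,j')\in X_\pi,\ \Delta_w(p,(l,j'))=0\},\qquad j'=\min\{k>j : (i,k)\in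 X_\pi\},$$ and $\mathrm{next}^{\uparrow}(p)=(i',j)$, where $$i'=\min\{l\le i : (l,j')\in X_\pi,\ \Delta_w(p,(l,j'))=0\},\qquad j'=\max\{k<j : (i,k)\in X_\pi\}.$$ Let $P^{\downarrow}(p)$ be the condition $\mathrm{rk}_\pi(\mathrm{next}^{\downarrow}(p))<\mathrm{rk}_\pi(p)$, and $P^{\uparrow}(p)$ the condition $\mathrm{rk}_\pi(\mathrm{next}^{\uparrow}(p))<\mathrm{rk}_\pi(p)$. **Proposition.** Suppose that $\pi=(w,x)$, $x\le w$, is smooth. Then for every $p\in\{0,\dots,n\}^2$ with $\mathrm{rk}_\pi(p)>0$ (such a $p$ lies in $\{1,\dots,n-1\}^2$), at least one of the four conditions $$P^{\downarrow}(p),\quad P^{\uparrow}(p),\quad P^{\uparrow}(\mathrm{next}^{\downarrow}(p)),\quad P^{\downarrow}(\mathrm{next}^{\uparrow}(p))$$ holds. -/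

import Mathlib

/-! Permutations of `{1, …, n}` are modelled by `Equiv.Perm (Fin n)`: the element `u` of
`{1, …, n}` is the element `u - 1` of `Fin n`. Points of the framed square have honest integer
coordinates in `{0, …, n}`. -/

namespace LevelSet

/-- The length of a permutation: the number of its inversions. -/
def length {n : ℕ} (w : Equiv.Perm (Fin n)) : ℕ :=
  (Finset.univ.filter fun q : Fin n × Fin n => q.1 < q.2 ∧ w q.2 < w q.1).card

/-- The Bruhat order on `S_n`: the reflexive transitive closure of the relation
`y → y t`, where `t` is a transposition such that `y t` is longer than `y`. -/
def BruhatLE {n : ℕ} : Equiv.Perm (Fin n) → Equiv.Perm (Fin n) → Prop :=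
  Relation.ReflTransGen fun y z =>
    ∃ t : Equiv.Perm (Fin n), t.IsSwap ∧ z = y * t ∧ length y < length z

/-- The strict Bruhat order. -/
def BruhatLT {n : ℕ} (y z : Equiv.Perm (Fin n)) : Prop :=
  BruhatLE y z ∧ y ≠ z

/-- The framed square `{0, …, n} × {0, …, n}`. -/
def framedSquare (n : ℕ) : Set (ℕ × ℕ) :=
  {p | p.1 ≤ n ∧ p.2 ≤ n}

/-- The rank function `rk_w(i, j) = #{u = 1, …, i : w(u) ≤ j}`. With the index shift, the
conditions `u ≤ i` and `w(u) ≤ j` become strict. -/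
def rk {n : ℕ} (w : Equiv.Perm (Fin n)) (p : ℕ × ℕ) : ℕ :=
  (Finset.univ.filter fun u : Fin n => (u : ℕ) < p.1 ∧ (w u : ℕ) < p.2).card

/-- The difference function
`Δ_w((i, j), (i', j')) = rk_w(i, j) + rk_w(i', j') - rk_w(i, j') - rk_w(i', j)`. -/
def diff {n : ℕ} (w : Equiv.Perm (Fin n)) (p p' : ℕ × ℕ) : ℤ :=
  (rk w p : ℤ) + rk w p' - rk w (p.1, p'.2) - rk w (p'.1, p.2)

/-- The set of pairs `(w, x)` of permutations with `x ≤ w` in the Bruhat order. -/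
def pairs (n : ℕ) : Set (Equiv.Perm (Fin n) × Equiv.Perm (Fin n)) :=
  {π | BruhatLE π.2 π.1}

section Pair

variable {n : ℕ} (π : Equiv.Perm (Fin n) × Equiv.Perm (Fin n))

/-- The rank function `rk_π = rk_x - rk_w` of `π = (w, x)`. -/
def pairRk (p : ℕ × ℕ) : ℤ :=
  (rk π.2 p : ℤ) - rk π.1 p

/-- The level set `{p : rk_π(p) = 0}` inside the framed square. -/
def levelSet : Set (ℕ × ℕ) :=
  {p | p ∈ framedSquare n ∧ pairRk π p = 0}

/-- The complement `{p : rk_π(p) > 0}` of the level set inside the framed square. -/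
def levelCompl : Set (ℕ × ℕ) :=
  {p | p ∈ framedSquare n ∧ 0 < pairRk π p}

/-- `ℓ(π) = ℓ(w) - ℓ(x)`. -/
def pairLength : ℤ :=
  (length π.1 : ℤ) - length π.2

/-- The set of transpositions `t` with `x < x t ≤ w`. -/
def reflections : Set (Equiv.Perm (Fin n)) :=
  {t | t.IsSwap ∧ BruhatLT π.2 (π.2 * t) ∧ BruhatLE (π.2 * t) π.1}

/-- The pair `π = (w, x)` is smooth if the number of transpositions `t` with `x < x t ≤ w`
equals `ℓ(w) - ℓ(x)`. -/
def IsSmooth : Prop :=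
  ((reflections π).ncard : ℤ) = pairLength π

/-- `min {k > j : (i, k) ∈ X_π}` for `p = (i, j)`; the set contains `n` when `j < n`. -/
noncomputable def colRight (p : ℕ × ℕ) : ℕ :=
  sInf {k | p.2 < k ∧ (p.1, k) ∈ levelSet π}

/-- `max {k < j : (i, k) ∈ X_π}` for `p = (i, j)`; the set contains `0` when `0 < j`. -/
noncomputable def colLeft (p : ℕ × ℕ) : ℕ :=
  sSup {k | k < p.2 ∧ (p.1, k) ∈ levelSet π}

/-- `next↓(p) = (i', j)` for `p = (i, j)`, where
`i' = max {l ≥ i : (l, j') ∈ X_π and Δ_w(p, (l, j')) = 0}` and `j' = min {k > j : (i, k) ∈ X_π}`.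
The first set contains `i`, and it is bounded by `n`. -/
noncomputable def nextDown (p : ℕ × ℕ) : ℕ × ℕ :=
  (sSup {l | p.1 ≤ l ∧ (l, colRight π p) ∈ levelSet π ∧ diff π.1 p (l, colRight π p) = 0}, p.2)

/-- `next↑(p) = (i', j)` for `p = (i, j)`, where
`i' = min {l ≤ i : (l, j') ∈ X_π and Δ_w(p, (l, j')) = 0}` and `j' = max {k < j : (i, k) ∈ X_π}`.
The first set contains `i`. -/
noncomputable def nextUp (p : ℕ × ℕ) : ℕ × ℕ :=
  (sInf {l | l ≤ p.1 ∧ (l, colLeft π p) ∈ levelSet π ∧ diff π.1 p (l, colLeft π p) = 0}, p.2)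

/-- The condition `P↓_π(p)`. -/
def PDown (p : ℕ × ℕ) : Prop :=
  pairRk π (nextDown π p) < pairRk π p

/-- The condition `P↑_π(p)`. -/
def PUp (p : ℕ × ℕ) : Prop :=
  pairRk π (nextUp π p) < pairRk π p

/-- The condition `Q_π(p)`. -/
def Q (p : ℕ × ℕ) : Prop :=
  PDown π p ∨ PUp π p ∨ PUp π (nextDown π p) ∨ PDown π (nextUp π p)

end Pair

end LevelSet

/-! Plot a permutation `y` as the points `(u, y u)`. An increasing transposition lowers `rk_y` by
one on a rectangle, so it keeps `y ≤ w` below `w` exactly when `rk_(w,y)` is positive there. The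
alternating sum of `rk_π` over the corners of a box is the number of points of `x` minus that of `w`
(`pairRk_box`); hence positivity spreads through boxes without points of `x`.

Smoothness enters once. For `y ≤ w`, the transpositions `t` with `y t ≤ w` number `ℓ(y)` plus the
number of reflections of `(w, y)`. This count does not increase as `y` goes up, and it is `ℓ(w)` at
`w`. Smoothness makes it `ℓ(w)` at `x` too, so it is constant on `[x, w]`. Were two disjoint
transpositions admissible at `y` separately but not together, it would drop strictly
(`IsSmooth.rankLE_mul_swap_mul_swap`).

If the four conditions fail at `(i, j)`, each failed step sweeps a box without points of `x` or `w`
and reaches a row with the same ranks. According to the position of the rows reached in two steps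
relative to `i`, two of these steps combine into a configuration `Pinched`.

`Pinched.not_of_isSmooth` excludes it. Take `y` in `[x, w]` as long as possible with the
configuration kept. Its rank at `(a, j)` is then 1, and there are two points at the upper left of
`(a, j)` and two at the lower right, each of the former exchangeable with each of the latter.
Exchanging two disjoint pairs at once would give rank `-1` at `(a, j)`. -/

namespace LevelSet

open Equiv

/-! ### Rank functions, boxes and transpositions -/

variable {n : ℕ}

/-- Comparison of rank functions; it agrees with the Bruhat order. -/
def RankLE (x y : Perm (Fin n)) : Prop :=
  ∀ p, rk y p ≤ rk x p

/-- The number of points of the graph of `y` in the box `[i, i') × [j, j')`. -/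
def boxCount (y : Perm (Fin n)) (i i' j j' : ℕ) : ℕ :=
  (Finset.univ.filter fun u : Fin n =>
    (i ≤ (u : ℕ) ∧ (u : ℕ) < i') ∧ j ≤ (y u : ℕ) ∧ (y u : ℕ) < j').card

theorem rk_eq_sum (y : Perm (Fin n)) (i j : ℕ) :
    (rk y (i, j) : ℤ) =
      ∑ u : Fin n, (if (u : ℕ) < i then 1 else 0) * (if (y u : ℕ) < j then 1 else 0) := by
  unfold rk
  rw [Finset.card_filter]
  push_cast
  refine Finset.sum_congr rfl fun u _ => ?_
  split_ifs <;> simp_all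

theorem rk_mul_swap (y : Perm (Fin n)) {a b : Fin n} (hab : a ≠ b) (i j : ℕ) :
    (rk (y * swap a b) (i, j) : ℤ) = rk y (i, j) -
      ((if (a : ℕ) < i then 1 else 0) - (if (b : ℕ) < i then 1 else 0)) *
        ((if (y a : ℕ) < j then 1 else 0) - (if (y b : ℕ) < j then 1 else 0)) := by
  rw [rk_eq_sum, rk_eq_sum, eq_sub_iff_add_eq, ← eq_sub_iff_add_eq', ← Finset.sum_sub_distrib,
    ← Finset.sum_subset (Finset.subset_univ {a, b}), Finset.sum_pair hab]
  · simp only [Perm.mul_apply, swap_apply_left, swap_apply_right]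
    ring
  · intro u _ hu
    simp only [Finset.mem_insert, Finset.mem_singleton, not_or] at hu
    simp [swap_apply_of_ne_of_ne hu.1 hu.2]

theorem rk_mul_swap_of_lt (y : Perm (Fin n)) {a b : Fin n} (hab : a < b) (hy : y a < y b)
    (i j : ℕ) : (rk (y * swap a b) (i, j) : ℤ) = rk y (i, j) -
      if ((a : ℕ) < i ∧ i ≤ b) ∧ (y a : ℕ) < j ∧ j ≤ y b then 1 else 0 := by
  rw [rk_mul_swap y hab.ne]
  have h1 : (a : ℕ) < b := hab
  have h2 : (y a : ℕ) < y b := hy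
  split_ifs <;> omega

theorem boxCount_eq (y : Perm (Fin n)) {i i' j j' : ℕ} (hi : i ≤ i') (hj : j ≤ j') :
    (boxCount y i i' j j' : ℤ) =
      rk y (i', j') + rk y (i, j) - rk y (i, j') - rk y (i', j) := by
  simp only [rk_eq_sum]
  rw [← Finset.sum_add_distrib, ← Finset.sum_sub_distrib, ← Finset.sum_sub_distrib, boxCount,
    Finset.card_filter]
  push_cast
  refine Finset.sum_congr rfl fun u _ => ?_
  split_ifs <;> omega

theorem boxCount_eq_zero {y : Perm (Fin n)} {i i' j j' : ℕ} :
    boxCount y i i' j j' = 0 ↔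
      ∀ u : Fin n, i ≤ (u : ℕ) → (u : ℕ) < i' → j ≤ (y u : ℕ) → (y u : ℕ) < j' → False := by
  rw [boxCount, Finset.card_eq_zero, Finset.filter_eq_empty_iff]
  constructor
  · intro h u h1 h2 h3 h4
    exact h (Finset.mem_univ u) ⟨⟨h1, h2⟩, h3, h4⟩
  · rintro h u - ⟨⟨h1, h2⟩, h3, h4⟩
    exact h u h1 h2 h3 h4

theorem exists_of_boxCount_pos {y : Perm (Fin n)} {i i' j j' : ℕ}
    (h : 0 < boxCount y i i' j j') :
    ∃ u : Fin n, i ≤ (u : ℕ) ∧ (u : ℕ) < i' ∧ j ≤ (y u : ℕ) ∧ (y u : ℕ) < j' := by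
  obtain ⟨u, hu⟩ := Finset.card_pos.1 h
  obtain ⟨-, ⟨h1, h2⟩, h3, h4⟩ := Finset.mem_filter.1 hu
  exact ⟨u, h1, h2, h3, h4⟩

/-- The box identity for the difference of two rank functions. -/
theorem pairRk_box (w x : Perm (Fin n)) {i i' j j' : ℕ} (hi : i ≤ i') (hj : j ≤ j') :
    pairRk (w, x) (i', j') + pairRk (w, x) (i, j) - pairRk (w, x) (i, j') - pairRk (w, x) (i', j) =
      boxCount x i i' j j' - boxCount w i i' j j' := by
  rw [boxCount_eq x hi hj, boxCount_eq w hi hj]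
  simp only [pairRk]
  ring

theorem rk_zero_left (y : Perm (Fin n)) (j : ℕ) : rk y (0, j) = 0 := by
  simp [rk]

theorem rk_zero_right (y : Perm (Fin n)) (i : ℕ) : rk y (i, 0) = 0 := by
  simp [rk]

theorem rk_top_right (y z : Perm (Fin n)) {j : ℕ} (i : ℕ) (hj : n ≤ j) :
    rk y (i, j) = rk z (i, j) := by
  have h (v : Fin n) : (v : ℕ) < j := v.2.trans_le hj
  simp [rk, h]

theorem rk_top_left (y z : Perm (Fin n)) {i : ℕ} (hi : n ≤ i) (j : ℕ) :
    rk y (i, j) = rk z (i, j) := by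
  have h (v : Fin n) : (v : ℕ) < i := v.2.trans_le hi
  have key (y : Perm (Fin n)) :
      (rk y (i, j) : ℤ) = ∑ u : Fin n, if (u : ℕ) < j then (1 : ℤ) else 0 := by
    rw [rk_eq_sum]
    simp only [h, if_true, one_mul]
    exact Equiv.sum_comp y fun u : Fin n => if (u : ℕ) < j then (1 : ℤ) else 0
  exact_mod_cast (key y).trans (key z).symm

theorem pairRk_zero_left (w x : Perm (Fin n)) (j : ℕ) : pairRk (w, x) (0, j) = 0 := by
  simp [pairRk, rk_zero_left]

theorem pairRk_zero_right (w x : Perm (Fin n)) (i : ℕ) : pairRk (w, x) (i, 0) = 0 := by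
  simp [pairRk, rk_zero_right]

theorem pairRk_top_right (w x : Perm (Fin n)) (i : ℕ) {j : ℕ} (hj : n ≤ j) :
    pairRk (w, x) (i, j) = 0 := by
  simp [pairRk, rk_top_right x w i hj]

theorem pairRk_top_left (w x : Perm (Fin n)) {i : ℕ} (hi : n ≤ i) (j : ℕ) :
    pairRk (w, x) (i, j) = 0 := by
  simp [pairRk, rk_top_left x w hi j]

theorem RankLE.pairRk_nonneg {x w : Perm (Fin n)} (h : RankLE x w) (p : ℕ × ℕ) :
    0 ≤ pairRk (w, x) p := by
  have := h p
  simp only [pairRk]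
  omega

theorem RankLE.refl (x : Perm (Fin n)) : RankLE x x := fun _ => le_rfl

theorem RankLE.trans {x y z : Perm (Fin n)} (h : RankLE x y) (h' : RankLE y z) : RankLE x z :=
  fun p => (h' p).trans (h p)

theorem rankLE_mul_swap {x : Perm (Fin n)} {a b : Fin n} (hab : a < b) (hx : x a < x b) :
    RankLE x (x * swap a b) := by
  rintro ⟨i, j⟩
  have := rk_mul_swap_of_lt x hab hx i j
  split_ifs at this <;> omega

theorem rankLE_of_mul_swap {x : Perm (Fin n)} {a b : Fin n} (hab : a < b) (hx : x b < x a) :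
    RankLE (x * swap a b) x := by
  have := rankLE_mul_swap (x := x * swap a b) hab (by simpa using hx)
  simpa [mul_assoc] using this

theorem pairRk_mul_swap (w x : Perm (Fin n)) {a b : Fin n} (hab : a < b) (hx : x a < x b)
    (i j : ℕ) : pairRk (w, x * swap a b) (i, j) = pairRk (w, x) (i, j) -
      if ((a : ℕ) < i ∧ i ≤ b) ∧ (x a : ℕ) < j ∧ j ≤ x b then 1 else 0 := by
  simp only [pairRk, rk_mul_swap_of_lt x hab hx i j]
  ring

/-- The swap lowers the rank of the pair by one on this rectangle and nowhere else, so nonnegativity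
can only be lost there. -/
theorem rankLE_mul_swap_iff {w x : Perm (Fin n)} (h : RankLE x w) {a b : Fin n} (hab : a < b)
    (hx : x a < x b) : RankLE (x * swap a b) w ↔
      ∀ k c : ℕ, (a : ℕ) < k → k ≤ b → (x a : ℕ) < c → c ≤ x b → 0 < pairRk (w, x) (k, c) := by
  constructor
  · intro h' k c h1 h2 h3 h4
    have := h'.pairRk_nonneg (k, c)
    rw [pairRk_mul_swap w x hab hx, if_pos ⟨⟨h1, h2⟩, h3, h4⟩] at this
    omega
  · rintro h' ⟨i, j⟩
    have e := pairRk_mul_swap w x hab hx i j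
    have h0 := h.pairRk_nonneg (i, j)
    split_ifs at e with hc
    · have := h' i j hc.1.1 hc.1.2 hc.2.1 hc.2.2
      simp only [pairRk] at *
      omega
    · simp only [pairRk] at *
      omega

/-! ### Length, and the Bruhat order in terms of ranks -/

theorem length_lt_length_mul_swap {x : Perm (Fin n)} {a b : Fin n} (hab : a < b)
    (hx : x a < x b) : length x < length (x * swap a b) := by
  classical
  set s := swap a b with hs
  have hss (u : Fin n) : s (s u) = u := by simp [hs]
  have hy (u : Fin n) : (x * s) u = x (s u) := rfl
  -- Applying `s` to both positions when their order survives, and nothing otherwise, injects the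
  -- inversions of `x` into those of `x s`; the inversion `(a, b)` is missed.
  let φ : Fin n × Fin n → Fin n × Fin n := fun q => if s q.1 < s q.2 then (s q.1, s q.2) else q
  unfold length
  rw [← Finset.card_image_of_injOn (f := φ)
    (s := Finset.univ.filter fun q : Fin n × Fin n => q.1 < q.2 ∧ x q.2 < x q.1)]
  · refine Finset.card_lt_card ((Finset.ssubset_iff_of_subset ?_).2 ⟨(a, b), ?_, ?_⟩)
    · intro q hq
      obtain ⟨⟨c, d⟩, hcd, rfl⟩ := Finset.mem_image.1 hq
      simp only [Finset.mem_filter, Finset.mem_univ, true_and] at hcd ⊢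
      obtain ⟨h1, h2⟩ := hcd
      by_cases h : s c < s d
      · simp only [φ, h, if_true, hy, hss]
        exact ⟨trivial, h2⟩
      · simp only [φ, h, if_false, hy]
        refine ⟨h1, ?_⟩
        rcases eq_or_ne c a with rfl | hca
        · rcases eq_or_ne d b with rfl | hdb
          · exact absurd h2 hx.asymm
          · rw [hs, swap_apply_left, swap_apply_of_ne_of_ne h1.ne' hdb]
            exact h2.trans hx
        · rcases eq_or_ne c b with rfl | hcb
          · have hda : d ≠ a := (hab.trans h1).ne'
            rw [hs, swap_apply_right, swap_apply_of_ne_of_ne hda h1.ne'] at h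
            exact absurd (hab.trans h1) h
          · rw [hs, swap_apply_of_ne_of_ne hca hcb] at h ⊢
            rcases eq_or_ne d a with rfl | hda
            · rw [swap_apply_left] at h
              exact absurd (h1.trans hab) h
            · rcases eq_or_ne d b with rfl | hdb
              · rw [swap_apply_right]
                exact hx.trans h2
              · rw [swap_apply_of_ne_of_ne hda hdb]
                exact h2
    · refine Finset.mem_filter.2 ⟨Finset.mem_univ _, hab, ?_⟩
      change x (s b) < x (s a)
      rw [hs, swap_apply_right, swap_apply_left]
      exact hx
    · intro hmem
      obtain ⟨⟨c, d⟩, hcd, hφ⟩ := Finset.mem_image.1 hmem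
      simp only [Finset.mem_filter, Finset.mem_univ, true_and] at hcd
      by_cases h : s c < s d
      · simp only [φ, h, if_true, Prod.mk.injEq] at hφ
        have h1 : c = b := by rw [← hss c, hφ.1, hs, swap_apply_left]
        have h2 : d = a := by rw [← hss d, hφ.2, hs, swap_apply_right]
        rw [h1, h2] at hcd
        exact hab.asymm hcd.1
      · simp only [φ, h, if_false, Prod.mk.injEq] at hφ
        rw [hφ.1, hφ.2] at hcd
        exact hx.asymm hcd.2
  · rintro ⟨c, d⟩ hcd ⟨c', d'⟩ hcd' h
    simp only [Finset.coe_filter, Finset.mem_univ, true_and, Set.mem_ofPred_eq] at hcd hcd'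
    by_cases h1 : s c < s d <;> by_cases h2 : s c' < s d' <;>
      simp only [φ, h1, h2, if_true, if_false, Prod.mk.injEq] at h
    · exact Prod.ext (s.injective h.1) (s.injective h.2)
    · rw [← h.1, ← h.2, hss, hss] at h2
      exact absurd hcd.1 h2
    · rw [h.1, h.2, hss, hss] at h1
      exact absurd hcd'.1 h1
    · exact Prod.ext h.1 h.2

theorem exists_lt_of_isSwap {t : Perm (Fin n)} (ht : t.IsSwap) :
    ∃ a b, a < b ∧ t = swap a b := by
  obtain ⟨a, b, hab, rfl⟩ := ht
  rcases hab.lt_or_gt with h | h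
  · exact ⟨a, b, h, rfl⟩
  · exact ⟨b, a, h, swap_comm a b⟩

theorem lt_of_length_lt {x : Perm (Fin n)} {a b : Fin n} (hab : a < b)
    (h : length x < length (x * swap a b)) : x a < x b := by
  rcases (x.injective.ne hab.ne).lt_or_gt with hx | hx
  · exact hx
  · have := length_lt_length_mul_swap (x := x * swap a b) hab (by simpa using hx)
    rw [mul_assoc, swap_mul_self, mul_one] at this
    exact absurd h this.asymm

theorem length_le (x : Perm (Fin n)) : length x ≤ Fintype.card (Fin n × Fin n) :=
  Finset.card_filter_le _ _

theorem BruhatLE.rankLE {x y : Perm (Fin n)} (h : BruhatLE x y) : RankLE x y := by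
  induction h with
  | refl => exact RankLE.refl x
  | tail _ h ih =>
    obtain ⟨t, ht, rfl, hl⟩ := h
    obtain ⟨a, b, hab, rfl⟩ := exists_lt_of_isSwap ht
    exact ih.trans (rankLE_mul_swap hab (lt_of_length_lt hab hl))

theorem rk_succ_left (y : Perm (Fin n)) (u : Fin n) (j : ℕ) :
    (rk y (u + 1, j) : ℤ) = rk y (u, j) + if (y u : ℕ) < j then 1 else 0 := by
  have h := boxCount_eq y (i := u) (i' := u + 1) (j := 0) (j' := j) (by omega) (by omega)
  simp only [rk_zero_right] at h
  have : boxCount y u (u + 1) 0 j = if (y u : ℕ) < j then 1 else 0 := by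
    unfold boxCount
    split_ifs with hu
    · rw [Finset.card_eq_one]
      refine ⟨u, ?_⟩
      ext v
      simp only [Finset.mem_filter, Finset.mem_univ, true_and, Finset.mem_singleton]
      constructor
      · rintro ⟨h, -⟩
        exact Fin.ext (by omega)
      · rintro rfl
        omega
    · rw [Finset.card_eq_zero, Finset.filter_eq_empty_iff]
      rintro v - ⟨h, -, h'⟩
      have : v = u := Fin.ext (by omega)
      rw [this] at h'
      exact hu h'
  rw [this] at h
  push_cast at h
  omega

/-- At the first row `u` where they differ, `x u < w u`. The next row `v` with `x u < x v ≤ w u`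
serves: strictly between these rows `x` has no point in the columns from `x u` to `w u`, so the rank
inequality at column `w u + 1` passes to column `c`, with a gain of one from row `u`, where only `x`
has its point left of `c`. -/
theorem exists_mul_swap_rankLE {x w : Perm (Fin n)} (h : RankLE x w) (hne : x ≠ w) :
    ∃ a b, a < b ∧ x a < x b ∧ RankLE (x * swap a b) w := by
  classical
  have hex : ∃ u, x u ≠ w u := by
    by_contra! hc
    exact hne (Equiv.ext hc)
  obtain ⟨u, hu, humin⟩ : ∃ u, x u ≠ w u ∧ ∀ v < u, x v = w v := by
    have := Finset.exists_minimal (s := Finset.univ.filter fun u => x u ≠ w u)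
      (by obtain ⟨u, hu⟩ := hex; exact ⟨u, by simpa using hu⟩)
    obtain ⟨u, hu⟩ := this
    refine ⟨u, by simpa using hu.1, fun v hv => ?_⟩
    by_contra hc
    exact absurd (hu.2 (by simpa using hc) hv.le) (not_le.2 hv)
  have hrow (j : ℕ) : rk x (u, j) = rk w (u, j) := by
    unfold rk
    congr 1
    ext v
    simp only [Finset.mem_filter, Finset.mem_univ, true_and]
    constructor <;> rintro ⟨h1, h2⟩ <;> refine ⟨h1, ?_⟩
    · rwa [← humin v h1]
    · rwa [humin v h1]
  have hxw : x u < w u := by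
    by_contra hc
    have hlt : w u < x u := lt_of_le_of_ne (not_lt.1 hc) (Ne.symm hu)
    have h1 := rk_succ_left x u (w u + 1)
    have h2 := rk_succ_left w u (w u + 1)
    have h3 := h (u + 1, w u + 1)
    rw [hrow] at h1
    have h4 : (w u : ℕ) < x u := hlt
    split_ifs at h1 h2 <;> omega
  obtain ⟨v₀, hv₀⟩ := x.surjective (w u)
  have hv₀u : u < v₀ := by
    rcases lt_trichotomy u v₀ with hlt | rfl | hlt
    · exact hlt
    · exact absurd hv₀ hu
    · rw [humin v₀ hlt] at hv₀
      exact absurd (w.injective hv₀) hlt.ne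
  obtain ⟨v, hv⟩ := Finset.exists_minimal
    (s := Finset.univ.filter fun v => u < v ∧ x u < x v ∧ x v ≤ w u)
    ⟨v₀, by simp [hv₀u, hv₀, hxw]⟩
  have hv1 := hv.1
  simp only [Finset.mem_filter, Finset.mem_univ, true_and] at hv1
  obtain ⟨huv, hxv, hvw⟩ := hv1
  have hmin (v' : Fin n) (h1 : u < v') (h2 : v' < v) (h3 : x u < x v') : w u < x v' := by
    by_contra hc
    exact absurd (hv.2 (by simpa using ⟨h1, h3, not_lt.1 hc⟩) h2.le) (not_le.2 h2)
  refine ⟨u, v, huv, hxv, (rankLE_mul_swap_iff h huv hxv).2 fun k c h1 h2 h3 h4 => ?_⟩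
  have hvw' : (x v : ℕ) ≤ w u := hvw
  have hxw' : (x u : ℕ) < w u := hxw
  have e1 := boxCount_eq x (i := u + 1) (i' := k) (j := x u) (j' := w u + 1) (by omega) (by omega)
  have z1 : boxCount x (u + 1) k (x u) (w u + 1) = 0 := by
    rw [boxCount_eq_zero]
    intro u' g1 g2 g3 g4
    have hne : u' ≠ u := by rintro rfl; omega
    have g5 : x u < x u' := lt_of_le_of_ne g3 (x.injective.ne hne.symm)
    have : (w u : ℕ) < x u' := hmin u' g1 (show (u' : ℕ) < v by omega) g5
    omega
  have e2 := boxCount_eq x (i := u + 1) (i' := k) (j := x u) (j' := c) (by omega) (by omega)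
  have z2 : boxCount x (u + 1) k (x u) c = 0 := by
    rw [boxCount_eq_zero] at z1 ⊢
    intro u' g1 g2 g3 g4
    exact z1 u' g1 g2 g3 (by omega)
  have e3 := boxCount_eq w (i := u + 1) (i' := k) (j := c) (j' := w u + 1) (by omega) (by omega)
  have a1 := rk_succ_left x u (x u)
  have a2 := rk_succ_left x u c
  have a3 := rk_succ_left x u (w u + 1)
  have b2 := rk_succ_left w u c
  have b3 := rk_succ_left w u (w u + 1)
  have hk := h (k, w u + 1)
  simp only [hrow] at a1 a2 a3
  simp only [pairRk]
  split_ifs at a1 a2 a3 b2 b3 <;> omega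

theorem RankLE.bruhatLE {x w : Perm (Fin n)} (h : RankLE x w) : BruhatLE x w := by
  induction hm : Fintype.card (Fin n × Fin n) - length x using Nat.strong_induction_on
    generalizing x with
  | _ m ih =>
    by_cases hne : x = w
    · rw [hne]
      exact Relation.ReflTransGen.refl
    · obtain ⟨a, b, hab, hx, hle⟩ := exists_mul_swap_rankLE h hne
      have hlt := length_lt_length_mul_swap hab hx
      have := length_le (x * swap a b)
      exact Relation.ReflTransGen.head ⟨swap a b, ⟨a, b, hab.ne, rfl⟩, rfl, hlt⟩
        (ih _ (by omega) hle rfl)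

theorem bruhatLE_iff_rankLE {x w : Perm (Fin n)} : BruhatLE x w ↔ RankLE x w :=
  ⟨BruhatLE.rankLE, RankLE.bruhatLE⟩

/-! ### Counting tangent transpositions; the use of smoothness -/

open Classical in
/-- The transpositions `t` with `x t ≤ w`. They span the tangent space of the Schubert variety
of `w` at the point `x`. -/
noncomputable def tangentSwaps (w x : Perm (Fin n)) : Finset (Perm (Fin n)) :=
  Finset.univ.filter fun t => t.IsSwap ∧ RankLE (x * t) w

theorem mem_tangentSwaps {w x t : Perm (Fin n)} :
    t ∈ tangentSwaps w x ↔ t.IsSwap ∧ RankLE (x * t) w := by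
  simp [tangentSwaps]

theorem swap_conj_left {a b c : Fin n} (hac : a ≠ c) (hbc : b ≠ c) :
    swap a b * swap a c * swap a b = swap b c := by
  rw [swap_comm a c, swap_comm b c]
  rw [swap_mul_swap_mul_swap hac.symm hbc.symm, swap_comm]

/-- A transposition either equals `(a b)`, or is disjoint from it, or moves exactly one of
`a` and `b`. -/
theorem swap_cases (a b : Fin n) {t : Perm (Fin n)} (ht : t.IsSwap) :
    t = swap a b ∨ (∃ c d, c < d ∧ t = swap c d ∧ c ≠ a ∧ c ≠ b ∧ d ≠ a ∧ d ≠ b) ∨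
      ∃ c, c ≠ a ∧ c ≠ b ∧ (t = swap a c ∨ t = swap b c) := by
  obtain ⟨c, d, hcd, rfl⟩ := exists_lt_of_isSwap ht
  by_cases h1 : c = a
  · subst h1
    by_cases h2 : d = b
    · exact Or.inl (by rw [h2])
    · exact Or.inr (Or.inr ⟨d, hcd.ne', h2, Or.inl rfl⟩)
  by_cases h2 : c = b
  · subst h2
    by_cases h3 : d = a
    · exact Or.inl (by rw [h3, swap_comm])
    · exact Or.inr (Or.inr ⟨d, h3, hcd.ne', Or.inr rfl⟩)
  by_cases h3 : d = a
  · subst h3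
    exact Or.inr (Or.inr ⟨c, h1, h2, Or.inl (swap_comm _ _)⟩)
  by_cases h4 : d = b
  · subst h4
    exact Or.inr (Or.inr ⟨c, h1, h2, Or.inr (swap_comm _ _)⟩)
  exact Or.inr (Or.inl ⟨c, d, hcd, rfl, h1, h2, h3, h4⟩)

section Up

variable {w x : Perm (Fin n)} {a b : Fin n}

theorem swap_disjoint_comm {c d : Fin n} (h1 : c ≠ a) (h2 : c ≠ b) (h3 : d ≠ a) (h4 : d ≠ b) :
    swap a b * swap c d = swap c d * swap a b := by
  have h : Perm.Disjoint (swap a b) (swap c d) := by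
    intro u
    by_cases hu : u = c ∨ u = d
    · left
      rcases hu with rfl | rfl
      · exact swap_apply_of_ne_of_ne h1 h2
      · exact swap_apply_of_ne_of_ne h3 h4
    · right
      exact swap_apply_of_ne_of_ne (fun h => hu (Or.inl h)) fun h => hu (Or.inr h)
  exact h.commute.eq

theorem rankLE_of_disjoint (hab : a < b) (hx : x a < x b) {c d : Fin n} (h1 : c ≠ a)
    (h2 : c ≠ b) (h3 : d ≠ a) (h4 : d ≠ b) (h : RankLE (x * swap a b * swap c d) w) :
    RankLE (x * swap c d) w := by
  rw [mul_assoc, swap_disjoint_comm h1 h2 h3 h4, ← mul_assoc] at h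
  refine (rankLE_mul_swap hab ?_).trans h
  simpa [swap_apply_of_ne_of_ne h1.symm h3.symm, swap_apply_of_ne_of_ne h2.symm h4.symm] using hx

theorem rk_mul_swap_mul_swap_left (x : Perm (Fin n)) {c : Fin n} (hab : a ≠ b) (hca : c ≠ a)
    (hcb : c ≠ b) (i j : ℕ) : (rk (x * swap a b * swap a c) (i, j) : ℤ) = rk x (i, j) -
      ((if (a : ℕ) < i then 1 else 0) - (if (b : ℕ) < i then 1 else 0)) *
        ((if (x a : ℕ) < j then 1 else 0) - (if (x b : ℕ) < j then 1 else 0)) -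
      ((if (a : ℕ) < i then 1 else 0) - (if (c : ℕ) < i then 1 else 0)) *
        ((if (x b : ℕ) < j then 1 else 0) - (if (x c : ℕ) < j then 1 else 0)) := by
  rw [rk_mul_swap _ hca.symm, rk_mul_swap _ hab]
  simp only [Perm.mul_apply, swap_apply_left, swap_apply_of_ne_of_ne hca hcb]

theorem rk_mul_swap_mul_swap_right (x : Perm (Fin n)) {c : Fin n} (hab : a ≠ b) (hca : c ≠ a)
    (hcb : c ≠ b) (i j : ℕ) : (rk (x * swap a b * swap b c) (i, j) : ℤ) = rk x (i, j) -
      ((if (a : ℕ) < i then 1 else 0) - (if (b : ℕ) < i then 1 else 0)) *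
        ((if (x a : ℕ) < j then 1 else 0) - (if (x b : ℕ) < j then 1 else 0)) -
      ((if (b : ℕ) < i then 1 else 0) - (if (c : ℕ) < i then 1 else 0)) *
        ((if (x a : ℕ) < j then 1 else 0) - (if (x c : ℕ) < j then 1 else 0)) := by
  rw [rk_mul_swap _ hcb.symm, rk_mul_swap _ hab]
  simp only [Perm.mul_apply, swap_apply_right, swap_apply_of_ne_of_ne hca hcb]

/-- At every single point, the ranks of `x (a c)` and of `x (b c)` are at least the smaller of the
ranks of the two products with three-cycles. -/
theorem rankLE_pair (hab : a < b) (hx : x a < x b) {c : Fin n} (hca : c ≠ a) (hcb : c ≠ b)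
    (h1 : RankLE (x * swap a b * swap a c) w) (h2 : RankLE (x * swap a b * swap b c) w) :
    RankLE (x * swap a c) w ∧ RankLE (x * swap b c) w := by
  have hab' : (a : ℕ) < b := hab
  have hx' : (x a : ℕ) < x b := hx
  constructor <;> rintro ⟨i, j⟩ <;> have g1 := h1 (i, j) <;> have g2 := h2 (i, j) <;>
    zify at g1 g2 ⊢ <;>
    rw [rk_mul_swap_mul_swap_left x hab.ne hca hcb] at g1 <;>
    rw [rk_mul_swap_mul_swap_right x hab.ne hca hcb] at g2
  · rw [rk_mul_swap _ hca.symm]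
    split_ifs at * <;> omega
  · rw [rk_mul_swap _ hcb.symm]
    split_ifs at * <;> omega

/-- If `c < b`, the product `x (a b) (a c)` arises from `x (a c)` by an increasing swap of `c` and
`b`; if `x a < x c`, from `x (b c)` by an increasing swap of `a` and `b`. In the remaining case `(a,
c)` is an inversion of `x`, and `x (a c)` is already below `x`. -/
theorem rankLE_or_left (hab : a < b) (hx : x a < x b) (hxw : RankLE x w) {c : Fin n}
    (hca : c ≠ a) (hcb : c ≠ b) (h : RankLE (x * swap a b * swap a c) w) :
    RankLE (x * swap a c) w ∨ RankLE (x * swap b c) w := by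
  have hab' : (a : ℕ) < b := hab
  have hx' : (x a : ℕ) < x b := hx
  by_cases h1 : c < b
  · have h1' : (c : ℕ) < b := h1
    left
    rintro ⟨i, j⟩
    have g := h (i, j)
    zify at g ⊢
    rw [rk_mul_swap_mul_swap_left x hab.ne hca hcb] at g
    rw [rk_mul_swap _ hca.symm]
    split_ifs at * <;> omega
  by_cases h2 : x a < x c
  · have h2' : (x a : ℕ) < x c := h2
    right
    rintro ⟨i, j⟩
    have g := h (i, j)
    zify at g ⊢
    rw [rk_mul_swap_mul_swap_left x hab.ne hca hcb] at g
    rw [rk_mul_swap _ hcb.symm]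
    split_ifs at * <;> omega
  have h3 : x c < x a := lt_of_le_of_ne (not_lt.1 h2) (x.injective.ne hca)
  exact Or.inl ((rankLE_of_mul_swap (hab.trans_le (not_lt.1 h1)) h3).trans hxw)

theorem rankLE_or_right (hab : a < b) (hx : x a < x b) (hxw : RankLE x w) {c : Fin n}
    (hca : c ≠ a) (hcb : c ≠ b) (h : RankLE (x * swap a b * swap b c) w) :
    RankLE (x * swap a c) w ∨ RankLE (x * swap b c) w := by
  have hab' : (a : ℕ) < b := hab
  have hx' : (x a : ℕ) < x b := hx
  by_cases h1 : a < c
  · have h1' : (a : ℕ) < c := h1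
    right
    rintro ⟨i, j⟩
    have g := h (i, j)
    zify at g ⊢
    rw [rk_mul_swap_mul_swap_right x hab.ne hca hcb] at g
    rw [rk_mul_swap _ hcb.symm]
    split_ifs at * <;> omega
  by_cases h2 : x c < x b
  · have h2' : (x c : ℕ) < x b := h2
    left
    rintro ⟨i, j⟩
    have g := h (i, j)
    zify at g ⊢
    rw [rk_mul_swap_mul_swap_right x hab.ne hca hcb] at g
    rw [rk_mul_swap _ hca.symm]
    split_ifs at * <;> omega
  have h3 : x b < x c := lt_of_le_of_ne (not_lt.1 h2) (x.injective.ne hcb.symm)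
  have h4 : c < b := (lt_of_le_of_ne (not_lt.1 h1) hca).trans hab
  right
  rw [swap_comm]
  exact (rankLE_of_mul_swap h4 h3).trans hxw

theorem swap_conj_right {c : Fin n} (hca : c ≠ a) (hcb : c ≠ b) :
    swap a b * swap b c * swap a b = swap a c := by
  rw [swap_comm a b]
  exact swap_conj_left hcb.symm hca.symm

theorem rankLE_or_conj (hab : a < b) (hx : x a < x b) (hxw : RankLE x w)
    (hle : RankLE (x * swap a b) w) {t : Perm (Fin n)} (ht : t.IsSwap)
    (h : RankLE (x * swap a b * t) w) :
    RankLE (x * t) w ∨ RankLE (x * (swap a b * t * swap a b)) w := by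
  rcases swap_cases a b ht with rfl | ⟨c, d, -, rfl, h1, h2, h3, h4⟩ | ⟨c, h1, h2, rfl | rfl⟩
  · exact Or.inl hle
  · exact Or.inl (rankLE_of_disjoint hab hx h1 h2 h3 h4 h)
  · rw [swap_conj_left h1.symm h2.symm]
    exact rankLE_or_left hab hx hxw h1 h2 h
  · rw [swap_conj_right h1 h2]
    exact (rankLE_or_right hab hx hxw h1 h2 h).symm

theorem rankLE_of_conj (hab : a < b) (hx : x a < x b) (hle : RankLE (x * swap a b) w)
    {t : Perm (Fin n)} (ht : t.IsSwap) (h : RankLE (x * swap a b * t) w)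
    (h' : RankLE (x * swap a b * (swap a b * t * swap a b)) w) : RankLE (x * t) w := by
  rcases swap_cases a b ht with rfl | ⟨c, d, -, rfl, h1, h2, h3, h4⟩ | ⟨c, h1, h2, rfl | rfl⟩
  · exact hle
  · exact rankLE_of_disjoint hab hx h1 h2 h3 h4 h
  · rw [swap_conj_left h1.symm h2.symm] at h'
    exact (rankLE_pair hab hx h1 h2 h h').1
  · rw [swap_conj_right h1 h2] at h'
    exact (rankLE_pair hab hx h1 h2 h' h).2

theorem isSwap_conj {s t : Perm (Fin n)} (hs : s.IsSwap) (ht : t.IsSwap) : (s * t * s).IsSwap := by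
  obtain ⟨c, d, hcd, rfl⟩ := ht
  obtain ⟨a, b, hab, rfl⟩ := hs
  refine ⟨swap a b c, swap a b d, (swap a b).injective.ne hcd, ?_⟩
  rw [Equiv.swap_apply_apply]
  simp

open Classical in
/-- An injection from `tangentSwaps w (x (a b))` to `tangentSwaps w x`. -/
noncomputable def transfer (w x : Perm (Fin n)) (a b : Fin n) (t : Perm (Fin n)) : Perm (Fin n) :=
  if RankLE (x * t) w then t else swap a b * t * swap a b

theorem transfer_mem (hab : a < b) (hx : x a < x b) (hxw : RankLE x w)
    (hle : RankLE (x * swap a b) w) {t : Perm (Fin n)} (ht : t ∈ tangentSwaps w (x * swap a b)) :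
    transfer w x a b t ∈ tangentSwaps w x := by
  rw [mem_tangentSwaps] at ht ⊢
  unfold transfer
  split_ifs with h
  · exact ⟨ht.1, h⟩
  · exact ⟨isSwap_conj ⟨a, b, hab.ne, rfl⟩ ht.1,
      (rankLE_or_conj hab hx hxw hle ht.1 ht.2).resolve_left h⟩

theorem conj_conj (a b : Fin n) (t : Perm (Fin n)) :
    swap a b * (swap a b * t * swap a b) * swap a b = t := by
  simp [mul_assoc]

/-- A collision would involve a transposition and its conjugate, both tangent at `x (a b)`; then
`rankLE_of_conj` makes both tangent at `x`, and neither is conjugated. -/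
theorem transfer_injOn (hab : a < b) (hx : x a < x b) (hle : RankLE (x * swap a b) w) :
    Set.InjOn (transfer w x a b) (tangentSwaps w (x * swap a b)) := by
  intro t ht t' ht' h
  rw [Finset.mem_coe, mem_tangentSwaps] at ht ht'
  unfold transfer at h
  split_ifs at h with h1 h2 h2
  · exact h
  · refine absurd (rankLE_of_conj hab hx hle ht'.1 ht'.2 ?_) h2
    rw [← h]
    exact ht.2
  · refine absurd (rankLE_of_conj hab hx hle ht.1 ht.2 ?_) h1
    rw [h]
    exact ht'.2
  · rw [← conj_conj a b t, h, conj_conj]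

theorem card_tangentSwaps_le (hab : a < b) (hx : x a < x b) (hle : RankLE (x * swap a b) w) :
    (tangentSwaps w (x * swap a b)).card ≤ (tangentSwaps w x).card :=
  Finset.card_le_card_of_injOn _
    (fun _ ht => transfer_mem hab hx ((rankLE_mul_swap hab hx).trans hle) hle ht)
    (transfer_injOn hab hx hle)

/-- Conjugation by `(a b)` fixes the disjoint transposition `(c d)`, whose only possible preimage
under `transfer` is therefore itself. -/
theorem card_tangentSwaps_lt (hab : a < b) (hx : x a < x b) (hle : RankLE (x * swap a b) w)
    {c d : Fin n} (hcd : c ≠ d) (h1 : c ≠ a) (h2 : c ≠ b) (h3 : d ≠ a) (h4 : d ≠ b)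
    (hle' : RankLE (x * swap c d) w) (hnot : ¬RankLE (x * swap a b * swap c d) w) :
    (tangentSwaps w (x * swap a b)).card < (tangentSwaps w x).card := by
  classical
  rw [← Finset.card_image_of_injOn (transfer_injOn hab hx hle)]
  refine Finset.card_lt_card ((Finset.ssubset_iff_of_subset ?_).2 ⟨swap c d, ?_, ?_⟩)
  · intro t ht
    obtain ⟨t', ht', rfl⟩ := Finset.mem_image.1 ht
    exact transfer_mem hab hx ((rankLE_mul_swap hab hx).trans hle) hle ht'
  · exact mem_tangentSwaps.2 ⟨⟨c, d, hcd, rfl⟩, hle'⟩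
  · intro hmem
    obtain ⟨t, ht, htr⟩ := Finset.mem_image.1 hmem
    have hconj : swap a b * swap c d * swap a b = swap c d := by
      rw [swap_disjoint_comm h1 h2 h3 h4, mul_assoc, swap_mul_self, mul_one]
    have : t = swap c d := by
      unfold transfer at htr
      split_ifs at htr
      · exact htr
      · rw [← conj_conj a b t, htr, hconj]
    rw [this] at ht
    exact hnot (mem_tangentSwaps.1 ht).2

end Up

theorem card_tangentSwaps_anti {w x y : Perm (Fin n)} (hxy : RankLE x y) (hyw : RankLE y w) :
    (tangentSwaps w y).card ≤ (tangentSwaps w x).card := by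
  have h := hxy.bruhatLE
  clear hxy
  induction h with
  | refl => exact le_rfl
  | tail _ h ih =>
    obtain ⟨t, ht, rfl, hl⟩ := h
    obtain ⟨a, b, hab, rfl⟩ := exists_lt_of_isSwap ht
    have hup := lt_of_length_lt hab hl
    exact (card_tangentSwaps_le hab hup hyw).trans (ih ((rankLE_mul_swap hab hup).trans hyw))

theorem swap_eq_swap_iff_of_lt {a b c d : Fin n} (hab : a < b) (hcd : c < d) :
    swap a b = swap c d ↔ a = c ∧ b = d := by
  refine ⟨fun h => ?_, by rintro ⟨rfl, rfl⟩; rfl⟩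
  have h1 : swap c d a = b := by rw [← h, swap_apply_left]
  by_cases hac : a = c
  · subst hac
    rw [swap_apply_left] at h1
    exact ⟨rfl, h1.symm⟩
  by_cases had : a = d
  · subst had
    rw [swap_apply_right] at h1
    subst h1
    exact absurd hab hcd.asymm
  · rw [swap_apply_of_ne_of_ne hac had] at h1
    exact absurd h1 hab.ne

/-- Transpositions that shorten `x` correspond to its inversions and stay below `w` because `x`
does; those that lengthen it are the reflections. -/
theorem card_tangentSwaps {w x : Perm (Fin n)} (hxw : RankLE x w) :
    (tangentSwaps w x).card = length x + (reflections (w, x)).ncard := by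
  classical
  rw [← Finset.card_filter_add_card_filter_not (s := tangentSwaps w x)
    (fun t => length (x * t) < length x)]
  congr 1
  · symm
    refine Finset.card_bij (fun q _ => swap q.1 q.2) ?_ ?_ ?_
    · rintro ⟨a, b⟩ hq
      obtain ⟨hab, hx⟩ : a < b ∧ x b < x a := by simpa using hq
      refine Finset.mem_filter.2 ⟨mem_tangentSwaps.2 ⟨⟨a, b, hab.ne, rfl⟩,
        (rankLE_of_mul_swap hab hx).trans hxw⟩, ?_⟩
      have := length_lt_length_mul_swap (x := x * swap a b) hab (by simpa using hx)
      simpa [mul_assoc] using this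
    · rintro ⟨a, b⟩ hq ⟨c, d⟩ hq' h
      obtain ⟨hab, -⟩ : a < b ∧ x b < x a := by simpa using hq
      obtain ⟨hcd, -⟩ : c < d ∧ x d < x c := by simpa using hq'
      obtain ⟨rfl, rfl⟩ := (swap_eq_swap_iff_of_lt hab hcd).1 h
      rfl
    · intro t ht
      obtain ⟨ht, hl⟩ := Finset.mem_filter.1 ht
      obtain ⟨a, b, hab, rfl⟩ := exists_lt_of_isSwap (mem_tangentSwaps.1 ht).1
      refine ⟨(a, b), ?_, rfl⟩
      have : x b < x a := by
        have := lt_of_length_lt (x := x * swap a b) hab (by simpa [mul_assoc] using hl)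
        simpa using this
      simpa using ⟨hab, this⟩
  · rw [← Set.ncard_coe_finset]
    congr 1
    ext t
    simp only [Finset.coe_filter, Set.mem_ofPred_eq, mem_tangentSwaps, reflections, BruhatLT,
      bruhatLE_iff_rankLE]
    constructor
    · rintro ⟨⟨ht, hle⟩, hl⟩
      obtain ⟨a, b, hab, rfl⟩ := exists_lt_of_isSwap ht
      have hx : x a < x b := by
        by_contra hc
        have hx : x b < x a := lt_of_le_of_ne (not_lt.1 hc) (x.injective.ne hab.ne')
        have := length_lt_length_mul_swap (x := x * swap a b) hab (by simpa using hx)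
        exact hl (by simpa [mul_assoc] using this)
      refine ⟨ht, ⟨rankLE_mul_swap hab hx, fun he => ?_⟩, hle⟩
      have := length_lt_length_mul_swap hab hx
      rw [← he] at this
      exact this.ne rfl
    · rintro ⟨ht, ⟨hle', hne⟩, hle⟩
      refine ⟨⟨ht, hle⟩, fun hl => ?_⟩
      obtain ⟨a, b, hab, rfl⟩ := exists_lt_of_isSwap ht
      have hx := lt_of_length_lt (x := x * swap a b) hab (by simpa [mul_assoc] using hl)
      have h1 : RankLE (x * swap a b) x := by
        have := rankLE_mul_swap (x := x * swap a b) hab hx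
        simpa [mul_assoc] using this
      have hx' : x b < x a := by simpa using hx
      have h2 := rk_mul_swap_of_lt (x * swap a b) hab hx (a + 1) (x b + 1)
      rw [mul_assoc, swap_mul_self, mul_one] at h2
      have h3 : (a : ℕ) < b := hab
      have h4 : (x b : ℕ) < x a := hx'
      have h5 := hle' (a + 1, x b + 1)
      simp only [Perm.mul_apply, swap_apply_left, swap_apply_right] at h2
      rw [if_pos (by omega)] at h2
      omega

theorem RankLE.antisymm {x y : Perm (Fin n)} (h : RankLE x y) (h' : RankLE y x) : x = y := by
  by_contra hne
  obtain ⟨a, b, hab, hx, hle⟩ := exists_mul_swap_rankLE h hne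
  have h1 := rk_mul_swap_of_lt x hab hx (a + 1) (x a + 1)
  have h2 := (hle.trans h') (a + 1, x a + 1)
  have h3 : (a : ℕ) < b := hab
  have h4 : (x a : ℕ) < x b := hx
  rw [if_pos (by omega)] at h1
  omega

theorem card_tangentSwaps_self (w : Perm (Fin n)) : (tangentSwaps w w).card = length w := by
  rw [card_tangentSwaps (RankLE.refl w)]
  have : reflections (w, w) = ∅ := by
    rw [Set.eq_empty_iff_forall_notMem]
    rintro t ⟨-, ⟨h1, h2⟩, h3⟩
    exact h2 (h1.rankLE.antisymm h3.rankLE)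
  rw [this, Set.ncard_empty, add_zero]

/-- If `(w, x)` is smooth and `y` lies between `x` and `w`, then two disjoint transpositions
leading from `y` to longer elements below `w` can be applied at the same time. -/
theorem IsSmooth.rankLE_mul_swap_mul_swap {w x y : Perm (Fin n)} (hs : IsSmooth (w, x))
    (hxy : RankLE x y) {a b c d : Fin n} (hab : a < b) (hy : y a < y b)
    (hle : RankLE (y * swap a b) w) (hcd : c ≠ d) (h1 : c ≠ a) (h2 : c ≠ b) (h3 : d ≠ a)
    (h4 : d ≠ b) (hle' : RankLE (y * swap c d) w) : RankLE (y * swap a b * swap c d) w := by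
  by_contra hnot
  have hyw : RankLE y w := (rankLE_mul_swap hab hy).trans hle
  have k1 := card_tangentSwaps_lt hab hy hle hcd h1 h2 h3 h4 hle' hnot
  have k2 := card_tangentSwaps_anti hxy hyw
  have k3 := card_tangentSwaps_anti hle (RankLE.refl w)
  rw [card_tangentSwaps_self] at k3
  rw [card_tangentSwaps (hxy.trans hyw)] at k2
  have k4 : ((reflections (w, x)).ncard : ℤ) = (length w : ℤ) - length x := hs
  omega

/-! ### Extremal columns and points -/

theorem exists_last_lt {P : ℕ → Prop} {l j : ℕ} (hlj : l < j) (hl : P l) (hj : ¬P j) :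
    ∃ c, l ≤ c ∧ c < j ∧ P c ∧ ∀ c', c < c' → c' ≤ j → ¬P c' := by
  classical
  have h1 : P (Nat.findGreatest P j) := Nat.findGreatest_spec hlj.le hl
  refine ⟨Nat.findGreatest P j, Nat.le_findGreatest hlj.le hl,
    lt_of_le_of_ne (Nat.findGreatest_le j) ?_, h1, fun c' h2 h3 => ?_⟩
  · intro h
    rw [h] at h1
    exact hj h1
  · exact Nat.findGreatest_is_greatest h2 h3

theorem exists_first_gt {P : ℕ → Prop} {j r : ℕ} (hjr : j < r) (hr : P r) (hj : ¬P j) :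
    ∃ c, j < c ∧ c ≤ r ∧ P c ∧ ∀ c', j ≤ c' → c' < c → ¬P c' := by
  classical
  have hex : ∃ c, j < c ∧ P c := ⟨r, hjr, hr⟩
  obtain ⟨h1, h2⟩ := Nat.find_spec hex
  refine ⟨Nat.find hex, h1, Nat.find_le ⟨hjr, hr⟩, h2, fun c' h3 h4 h5 => ?_⟩
  rcases h3.eq_or_lt with rfl | h3
  · exact hj h5
  · exact Nat.find_min hex h4 ⟨h3, h5⟩

theorem exists_lowest {y : Perm (Fin n)} {i i' j j' : ℕ} (h : 0 < boxCount y i i' j j') :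
    ∃ u : Fin n, i ≤ (u : ℕ) ∧ (u : ℕ) < i' ∧ j ≤ (y u : ℕ) ∧ (y u : ℕ) < j' ∧
      boxCount y (u + 1) i' j j' = 0 := by
  obtain ⟨u, hu, hmax⟩ := Finset.exists_max_image _ (fun u : Fin n => (u : ℕ)) (Finset.card_pos.1 h)
  obtain ⟨-, ⟨h1, h2⟩, h3, h4⟩ := Finset.mem_filter.1 hu
  refine ⟨u, h1, h2, h3, h4, boxCount_eq_zero.2 fun v g1 g2 g3 g4 => ?_⟩
  have := hmax v (Finset.mem_filter.2 ⟨Finset.mem_univ v, ⟨by omega, g2⟩, g3, g4⟩)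
  omega

theorem exists_leftmost {y : Perm (Fin n)} {i i' j j' : ℕ} (h : 0 < boxCount y i i' j j') :
    ∃ u : Fin n, i ≤ (u : ℕ) ∧ (u : ℕ) < i' ∧ j ≤ (y u : ℕ) ∧ (y u : ℕ) < j' ∧
      boxCount y i i' j (y u) = 0 := by
  obtain ⟨u, hu, hmin⟩ :=
    Finset.exists_min_image _ (fun u : Fin n => (y u : ℕ)) (Finset.card_pos.1 h)
  obtain ⟨-, ⟨h1, h2⟩, h3, h4⟩ := Finset.mem_filter.1 hu
  refine ⟨u, h1, h2, h3, h4, boxCount_eq_zero.2 fun v g1 g2 g3 g4 => ?_⟩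
  have := hmin v (Finset.mem_filter.2 ⟨Finset.mem_univ v, ⟨g1, g2⟩, g3, by omega⟩)
  omega

theorem boxCount_mono (y : Perm (Fin n)) {i i' j j' k k' l l' : ℕ} (h1 : k ≤ i) (h2 : i' ≤ k')
    (h3 : l ≤ j) (h4 : j' ≤ l') : boxCount y i i' j j' ≤ boxCount y k k' l l' := by
  refine Finset.card_le_card fun u hu => ?_
  simp only [Finset.mem_filter, Finset.mem_univ, true_and] at hu ⊢
  omega

/-! ### Pinched configurations -/

/-- A configuration around the points `(a, j)` and `(b, j)` that smoothness forbids. The rows `a`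
and `b` have rank zero at the columns `l` and `r`, positive equal ranks between them, and the
rows from `a` to `b` have no points of `w` or `x` there. Going up along the column `l`, or down
along the column `r`, no point of rank zero is reached before a point of `w` has been passed. -/
structure Pinched (w x : Perm (Fin n)) (a b l j r : ℕ) : Prop where
  hab : a ≤ b
  hbn : b ≤ n
  hlj : l < j
  hjr : j < r
  hrn : r ≤ n
  zero_left : pairRk (w, x) (a, l) = 0
  zero_right : pairRk (w, x) (a, r) = 0
  pos : ∀ c, l < c → c < r → 0 < pairRk (w, x) (a, c)
  same : ∀ c, l ≤ c → c ≤ r → pairRk (w, x) (b, c) = pairRk (w, x) (a, c)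
  empty : boxCount x a b l r = 0
  empty' : boxCount w a b l r = 0
  above : ∀ k < a, pairRk (w, x) (k, l) = 0 → 0 < boxCount w k a l j
  below : ∀ k, b < k → k ≤ n → pairRk (w, x) (k, r) = 0 → 0 < boxCount w b k j r

namespace Pinched

variable {w x : Perm (Fin n)} {a b l j r : ℕ}

theorem mid (h : Pinched w x a b l j r) {k c : ℕ} (h1 : a ≤ k) (h2 : k ≤ b) (h3 : l ≤ c)
    (h4 : c ≤ r) : pairRk (w, x) (k, c) = pairRk (w, x) (a, c) + pairRk (w, x) (k, l) := by
  have e := pairRk_box w x h1 h3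
  have e1 := boxCount_mono x (le_refl a) h2 (le_refl l) h4
  have e2 := boxCount_mono w (le_refl a) h2 (le_refl l) h4
  have := h.zero_left
  have := h.empty
  have := h.empty'
  omega

/-- Multiplication by a transposition that does not disturb the essential rank conditions
preserves the configuration. -/
theorem mul_swap (h : Pinched w x a b l j r) {u v : Fin n} (huv : u < v) (hx : x u < x v)
    (hu : (u : ℕ) < a ∨ b ≤ u) (hv : (v : ℕ) < a ∨ b ≤ v) (hl : l ≤ x u) (hr : x v < r)
    (hpos : ∀ c : ℕ, (u : ℕ) < a → a ≤ v → (x u : ℕ) < c → c ≤ x v → 2 ≤ pairRk (w, x) (a, c)) :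
    Pinched w (x * swap u v) a b l j r := by
  have huv' : (u : ℕ) < v := huv
  have hab := h.hab
  -- The rank changes only in the columns `x u < c ≤ x v`, all strictly between `l` and `r`.
  have key (i c : ℕ) (hc : c ≤ l ∨ r ≤ c) :
      pairRk (w, x * swap u v) (i, c) = pairRk (w, x) (i, c) := by
    rw [pairRk_mul_swap w x huv hx, if_neg (by omega), sub_zero]
  refine ⟨h.hab, h.hbn, h.hlj, h.hjr, h.hrn, ?_, ?_, ?_, ?_, ?_, h.empty', ?_, ?_⟩
  · rw [key _ _ (Or.inl le_rfl)]
    exact h.zero_left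
  · rw [key _ _ (Or.inr le_rfl)]
    exact h.zero_right
  · intro c h1 h2
    have h3 := h.pos c h1 h2
    rw [pairRk_mul_swap w x huv hx]
    split_ifs with hc
    · have := hpos c hc.1.1 hc.1.2 hc.2.1 hc.2.2
      omega
    · omega
  · intro c h1 h2
    -- Neither `u` nor `v` lies in `[a, b)`, so the rows `a` and `b` change together.
    have h3 := h.same c h1 h2
    rw [pairRk_mul_swap w x huv hx, pairRk_mul_swap w x huv hx]
    split_ifs <;> omega
  · have h1 := boxCount_eq_zero.1 h.empty
    refine boxCount_eq_zero.2 fun z g1 g2 g3 g4 => ?_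
    have hzu : z ≠ u := by rintro rfl; omega
    have hzv : z ≠ v := by rintro rfl; omega
    rw [Perm.mul_apply, swap_apply_of_ne_of_ne hzu hzv] at g3 g4
    exact h1 z g1 g2 g3 g4
  · intro k hk h1
    rw [key _ _ (Or.inl le_rfl)] at h1
    exact h.above k hk h1
  · intro k hk hk' h1
    rw [key _ _ (Or.inr le_rfl)] at h1
    exact h.below k hk hk' h1

/-- If the rank at `(a, j)` is at least two, then `x` can be enlarged within the configuration. -/
theorem exists_mul_swap_of_two_le (h : Pinched w x a b l j r) (hle : RankLE x w)
    (h2 : 2 ≤ pairRk (w, x) (a, j)) :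
    ∃ u v, u < v ∧ x u < x v ∧ RankLE (x * swap u v) w ∧ Pinched w (x * swap u v) a b l j r := by
  have hnn := hle.pairRk_nonneg
  have hab := h.hab
  have hbn := h.hbn
  -- Strictly between `c₀` and `d₀` row `a` has rank at least two, so a drop by one keeps it
  -- positive.
  obtain ⟨c₀, hlc, hcj, hc0, hc1⟩ := exists_last_lt (P := fun c => pairRk (w, x) (a, c) ≤ 1) h.hlj
    (by have := h.zero_left; omega) (by omega)
  obtain ⟨d₀, hjd, hdr, hd0, hd1⟩ := exists_first_gt (P := fun c => pairRk (w, x) (a, c) ≤ 1) h.hjr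
    (by have := h.zero_right; omega) (by omega)
  have hrow (c : ℕ) (g1 : c₀ < c) (g2 : c < d₀) : 2 ≤ pairRk (w, x) (a, c) := by
    rcases le_total c j with g3 | g3
    · have := hc1 c g1 g3
      omega
    · have := hd1 c g3 g2
      omega
  obtain ⟨A, -, hA1, hA2, hA3⟩ : ∃ u : Fin n, 0 ≤ (u : ℕ) ∧ (u : ℕ) < a ∧ c₀ ≤ (x u : ℕ) ∧
      (x u : ℕ) < j := by
    refine exists_of_boxCount_pos ?_
    have e := pairRk_box w x (Nat.zero_le a) hcj.le
    rw [pairRk_zero_left, pairRk_zero_left] at e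
    omega
  obtain ⟨D, hD1, -, hD2, hD3⟩ : ∃ u : Fin n, b ≤ (u : ℕ) ∧ (u : ℕ) < n ∧ j ≤ (x u : ℕ) ∧
      (x u : ℕ) < d₀ := by
    refine exists_of_boxCount_pos ?_
    have e := pairRk_box w x hbn hjd.le
    rw [pairRk_top_left w x le_rfl, pairRk_top_left w x le_rfl, h.same j h.hlj.le h.hjr.le,
      h.same d₀ (by omega) hdr] at e
    omega
  -- A pair at minimal row distance leaves no point of `x` in the boxes used below. There the box
  -- identity costs at most the rank at `c₀` or `d₀`, which is at most 1, out of a rank at least 2.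
  obtain ⟨⟨u, v⟩, huv, hmin⟩ := Finset.exists_min_image
    (Finset.univ.filter fun q : Fin n × Fin n => ((q.1 : ℕ) < a ∧ b ≤ (q.2 : ℕ)) ∧
      c₀ ≤ (x q.1 : ℕ) ∧ (x q.1 : ℕ) < x q.2 ∧ (x q.2 : ℕ) < d₀)
    (fun q => (q.2 : ℕ) - q.1)
    ⟨(A, D), Finset.mem_filter.2 ⟨Finset.mem_univ _, ⟨hA1, hD1⟩, hA2, by simp only; omega, hD3⟩⟩
  obtain ⟨-, ⟨hu, hv⟩, hu', hxuv, hv'⟩ := Finset.mem_filter.1 huv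
  simp only at hu hv hu' hxuv hv'
  have huv' : u < v := show (u : ℕ) < v by omega
  refine ⟨u, v, huv', hxuv, (rankLE_mul_swap_iff hle huv' hxuv).2 fun k c g1 g2 g3 g4 => ?_,
    h.mul_swap huv' hxuv (Or.inl hu) (Or.inr hv) (by omega) (by omega)
      fun c _ _ g3 g4 => hrow c (by omega) (by omega)⟩
  have hc := hrow c (by omega) (by omega)
  rcases le_or_gt k a with hk | hk
  · have e := pairRk_box w x hk (show c₀ ≤ c by omega)
    have hz : boxCount x k a c₀ c = 0 := by
      refine boxCount_eq_zero.2 fun z q1 q2 q3 q4 => ?_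
      have := hmin (z, v) (Finset.mem_filter.2
        ⟨Finset.mem_univ _, ⟨q2, hv⟩, q3, by simp only; omega, hv'⟩)
      simp only at this
      omega
    have := hnn (k, c₀)
    omega
  rcases le_or_gt k b with hk' | hk'
  · have e := h.mid hk.le hk' (show l ≤ c by omega) (by omega)
    have := hnn (k, l)
    omega
  · have e := pairRk_box w x hk'.le (show c ≤ d₀ by omega)
    have hz : boxCount x b k c d₀ = 0 := by
      refine boxCount_eq_zero.2 fun z q1 q2 q3 q4 => ?_
      have := hmin (u, z) (Finset.mem_filter.2
        ⟨Finset.mem_univ _, ⟨hu, q1⟩, hu', by simp only; omega, q4⟩)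
      simp only at this
      omega
    have := hnn (k, d₀)
    have := h.same c (by omega) (by omega)
    have := h.same d₀ (by omega) hdr
    omega

end Pinched

/-! ### Two exchangeable points on either side -/

section Above

variable {w x : Perm (Fin n)} {a l j r : ℕ}

/-- There are two points of `x` above row `a` between the columns `l` and `j` whose corner
rectangles at `(a, j)` consist of points of positive rank. -/
theorem exists_two_corners (hnn : ∀ p, 0 ≤ pairRk (w, x) p) (hlj : l < j) (hjr : j < r)
    (hl : pairRk (w, x) (a, l) = 0) (hpos : ∀ c, l < c → c < r → 0 < pairRk (w, x) (a, c))
    (hj : pairRk (w, x) (a, j) = 1)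
    (habove : ∀ k < a, pairRk (w, x) (k, l) = 0 → 0 < boxCount w k a l j) :
    ∃ u v : Fin n, u ≠ v ∧ ∀ z, z = u ∨ z = v → (z : ℕ) < a ∧ l ≤ x z ∧ x z < j ∧
      ∀ k c : ℕ, (z : ℕ) < k → k ≤ a → (x z : ℕ) < c → c ≤ j → 0 < pairRk (w, x) (k, c) := by
  classical
  have ha : 0 < a := by
    rcases Nat.eq_zero_or_pos a with rfl | h
    · rw [pairRk_zero_left] at hj
      omega
    · exact h
  -- Row `0` has rank zero, so `w` has a point above row `a` in the columns `[l, j)`; as the rank at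
  -- `(a, j)` is 1, `x` has at least two there.
  have hw := habove 0 ha (pairRk_zero_left w x l)
  have htot := pairRk_box w x (Nat.zero_le a) hlj.le
  rw [pairRk_zero_left, pairRk_zero_left] at htot
  obtain ⟨A₀, -, hA1, hA2, hA3, hA4⟩ := exists_lowest (y := x) (i := 0) (i' := a) (j := l)
    (j' := j) (by omega)
  have hcorner : ∀ k c : ℕ, (A₀ : ℕ) < k → k ≤ a → (x A₀ : ℕ) < c → c ≤ j →
      0 < pairRk (w, x) (k, c) := by
    intro k c h1 h2 h3 h4
    have e := pairRk_box w x h2 (show l ≤ c by omega)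
    have := boxCount_mono x (show A₀ + 1 ≤ k from h1) (le_refl a) (le_refl l) h4
    have := hnn (k, l)
    have := hpos c (by omega) (by omega)
    omega
  obtain ⟨A₁, hB, hmax⟩ := Finset.exists_max_image
    ((Finset.univ.filter fun u : Fin n =>
      (0 ≤ (u : ℕ) ∧ (u : ℕ) < a) ∧ l ≤ (x u : ℕ) ∧ (x u : ℕ) < j).erase A₀)
    (fun u => (u : ℕ))
    (Finset.card_pos.1 ((show 0 < boxCount x 0 a l j - 1 by omega).trans_le
      Finset.pred_card_le_card_erase))
  obtain ⟨hne, hB⟩ := Finset.mem_erase.1 hB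
  obtain ⟨-, ⟨-, hB1⟩, hB2, hB3⟩ := Finset.mem_filter.1 hB
  have honly (u : Fin n) (h1 : (A₁ : ℕ) < u) (h2 : (u : ℕ) < a) (h3 : l ≤ (x u : ℕ))
      (h4 : (x u : ℕ) < j) : u = A₀ := by
    by_contra hc
    have := hmax u (Finset.mem_erase.2 ⟨hc, Finset.mem_filter.2
      ⟨Finset.mem_univ u, ⟨Nat.zero_le _, h2⟩, h3, h4⟩⟩)
    omega
  by_cases hbad : ∃ c, ∃ k : ℕ, (A₁ : ℕ) < k ∧ k ≤ a ∧ (x A₁ : ℕ) < c ∧ c ≤ j ∧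
      pairRk (w, x) (k, c) = 0
  -- The second lowest point `A₁` fails because of a zero `(k, c)`, taken in the last possible
  -- column. The box from it down to row `a` and left to column `l` has `A₀` as its only point of
  -- `x`, which forces rank zero at `(k, l)`. Now `habove` supplies a point of `w` that makes the
  -- rank at `(k, j)` positive, so `x` has points above row `k` in the columns `[c, j)`; the lowest
  -- one replaces `A₁`.
  · obtain ⟨c, ⟨k, hk1, hk2, hc1, hc2, hz⟩, hcmax⟩ :
        ∃ c, (∃ k : ℕ, (A₁ : ℕ) < k ∧ k ≤ a ∧ (x A₁ : ℕ) < c ∧ c ≤ j ∧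
          pairRk (w, x) (k, c) = 0) ∧ ∀ k c' : ℕ, c < c' → c' ≤ j → (A₁ : ℕ) < k → k ≤ a →
          0 < pairRk (w, x) (k, c') := by
      obtain ⟨c, hc⟩ := hbad
      -- The search stops at `j + 1`, where the clause `c ≤ j` fails.
      obtain ⟨c', -, h2, h3, h4⟩ := exists_last_lt (P := fun c => ∃ k : ℕ, (A₁ : ℕ) < k ∧ k ≤ a ∧
        (x A₁ : ℕ) < c ∧ c ≤ j ∧ pairRk (w, x) (k, c) = 0) (l := c) (j := j + 1)
        (by obtain ⟨k, hk⟩ := hc; omega) hc (by rintro ⟨k, hk⟩; omega)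
      refine ⟨c', h3, fun k d q1 q2 q3 q4 => ?_⟩
      have := hnn (k, d)
      obtain ⟨k', hk'⟩ := h3
      rcases this.eq_or_lt with he | hlt
      · exact absurd ⟨k, q3, q4, by omega, q2, he.symm⟩ (h4 d q1 (by omega))
      · exact hlt
    have hone (d : ℕ) (hd : d ≤ j) : boxCount x k a l d ≤ 1 := by
      refine Finset.card_le_one.2 fun u hu v hv => ?_
      obtain ⟨-, ⟨q1, q2⟩, q3, q4⟩ := Finset.mem_filter.1 hu
      obtain ⟨-, ⟨s1, s2⟩, s3, s4⟩ := Finset.mem_filter.1 hv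
      rw [honly u (by omega) q2 q3 (by omega), honly v (by omega) s2 s3 (by omega)]
    have e := pairRk_box w x hk2 (show l ≤ c by omega)
    have h1 := hone c hc2
    have h2 := hnn (k, l)
    have h3 := hpos c (by omega) (by omega)
    obtain ⟨u, q1, q2, q3, q4⟩ := exists_of_boxCount_pos (show 0 < boxCount x k a l c by omega)
    obtain rfl := honly u (by omega) q2 q3 (by omega)
    have hw' := habove k (by omega) (by omega)
    have e' := pairRk_box w x hk2 hlj.le
    have h1' := hone j le_rfl
    have e'' := pairRk_box w x (Nat.zero_le k) hc2
    rw [pairRk_zero_left, pairRk_zero_left] at e''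
    obtain ⟨A₂, -, hC1, hC2, hC3, hC4⟩ := exists_lowest (y := x) (i := 0) (i' := k) (j := c)
      (j' := j) (by omega)
    refine ⟨u, A₂, by rintro rfl; omega, ?_⟩
    rintro z (rfl | rfl)
    · exact ⟨hA1, hA2, hA3, hcorner⟩
    · refine ⟨by omega, by omega, hC3, fun k' c' g1 g2 g3 g4 => ?_⟩
      rcases le_or_gt k' k with hk | hk
      · have e3 := pairRk_box w x hk (show c ≤ c' by omega)
        have := boxCount_mono x (show z + 1 ≤ k' from g1) (le_refl k) (le_refl c) g4
        have := hcmax k c' (by omega) g4 hk1 hk2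
        have := hnn (k', c)
        omega
      · exact hcmax k' c' (by omega) g4 (by omega) g2
  · refine ⟨A₀, A₁, hne.symm, ?_⟩
    rintro z (rfl | rfl)
    · exact ⟨hA1, hA2, hA3, hcorner⟩
    · refine ⟨hB1, hB2, hB3, fun k c h1 h2 h3 h4 => ?_⟩
      by_contra hc
      exact hbad ⟨c, k, h1, h2, h3, h4, le_antisymm (not_lt.1 hc) (hnn _)⟩

/-- Stuckness extends the corners from column `j` to column `r`. If `x` had points below row `z` and
above row `a` in the columns `[j, r)`, the leftmost could be swapped with `z`: up to its column the
box identity, with rank 1 at `(a, j)`, keeps ranks positive. Without such points the same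
computation reaches every column before `r`. -/
theorem exists_two_above (hnn : ∀ p, 0 ≤ pairRk (w, x) p) (hlj : l < j) (hjr : j < r)
    (hl : pairRk (w, x) (a, l) = 0) (hpos : ∀ c, l < c → c < r → 0 < pairRk (w, x) (a, c))
    (hj : pairRk (w, x) (a, j) = 1)
    (habove : ∀ k < a, pairRk (w, x) (k, l) = 0 → 0 < boxCount w k a l j)
    (hstuck : ∀ u v : Fin n, u < v → (v : ℕ) < a → l ≤ x u → x u < x v → x v < r →
      ∃ k c : ℕ, ((u : ℕ) < k ∧ k ≤ v) ∧ ((x u : ℕ) < c ∧ c ≤ x v) ∧ pairRk (w, x) (k, c) = 0) :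
    ∃ u v : Fin n, u ≠ v ∧ ∀ z, z = u ∨ z = v → (z : ℕ) < a ∧ l ≤ x z ∧ x z < j ∧
      ∀ k c : ℕ, (z : ℕ) < k → k ≤ a → (x z : ℕ) < c → c < r → 0 < pairRk (w, x) (k, c) := by
  obtain ⟨u, v, huv, h⟩ := exists_two_corners hnn hlj hjr hl hpos hj habove
  refine ⟨u, v, huv, fun z hz => ?_⟩
  obtain ⟨h1, h2, h3, h4⟩ := h z hz
  have hright (d k c : ℕ) (hd : boxCount x (z + 1) a j d = 0) (g1 : (z : ℕ) < k) (g2 : k ≤ a)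
      (g3 : j ≤ c) (g4 : c ≤ d) (g5 : c < r) : 0 < pairRk (w, x) (k, c) := by
    have e := pairRk_box w x g2 g3
    have := boxCount_mono x (show z + 1 ≤ k from g1) (le_refl a) (le_refl j) g4
    have := h4 k j g1 g2 h3 le_rfl
    have := hpos c (by omega) g5
    omega
  have hempty : boxCount x (z + 1) a j r = 0 := by
    by_contra hne
    obtain ⟨v, q1, q2, q3, q4, q5⟩ := exists_leftmost (Nat.pos_of_ne_zero hne)
    obtain ⟨k, c, ⟨s1, s2⟩, ⟨s3, s4⟩, s5⟩ := hstuck z v (show (z : ℕ) < v by omega) q2 h2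
      (show (x z : ℕ) < x v by omega) q4
    rcases le_or_gt c j with hc | hc
    · have := h4 k c s1 (by omega) s3 hc
      omega
    · have := hright (x v) k c q5 s1 (by omega) hc.le s4 (by omega)
      omega
  refine ⟨h1, h2, h3, fun k c g1 g2 g3 g4 => ?_⟩
  rcases le_or_gt c j with hc | hc
  · exact h4 k c g1 g2 g3 hc
  · exact hright r k c hempty g1 g2 hc.le g4.le g4

end Above

/-- The permutation whose graph is obtained by rotating the graph of `y` by half a turn. -/
def rotate (y : Perm (Fin n)) : Perm (Fin n) :=
  Fin.revPerm * y * Fin.revPerm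

theorem rotate_apply (y : Perm (Fin n)) (u : Fin n) : rotate y u = (y u.rev).rev := rfl

theorem boxCount_rotate (y : Perm (Fin n)) {i i' j j' : ℕ} (hi : i' ≤ n) (hj : j' ≤ n) :
    boxCount (rotate y) (n - i') (n - i) (n - j') (n - j) = boxCount y i i' j j' := by
  refine Finset.card_bij (fun u _ => u.rev) ?_ (fun _ _ _ _ h => Fin.rev_injective h) ?_
  · intro u hu
    obtain ⟨-, hu⟩ := Finset.mem_filter.1 hu
    refine Finset.mem_filter.2 ⟨Finset.mem_univ _, ?_⟩
    simp only [rotate_apply, Fin.val_rev] at hu ⊢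
    have := u.2
    have := (y u.rev).2
    omega
  · intro u hu
    refine ⟨u.rev, Finset.mem_filter.2 ⟨Finset.mem_univ _, ?_⟩, Fin.rev_rev u⟩
    obtain ⟨-, hu⟩ := Finset.mem_filter.1 hu
    simp only [rotate_apply, Fin.val_rev, Fin.rev_rev] at hu ⊢
    have := u.2
    have := (y u).2
    omega

theorem pairRk_rotate (w x : Perm (Fin n)) {i j : ℕ} (hi : i ≤ n) (hj : j ≤ n) :
    pairRk (rotate w, rotate x) (n - i, n - j) = pairRk (w, x) (i, j) := by
  have e1 := pairRk_box (rotate w) (rotate x) (Nat.zero_le (n - i)) (Nat.zero_le (n - j))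
  have e2 := pairRk_box w x hi hj
  have e3 := boxCount_rotate x (i := i) (j := j) le_rfl le_rfl
  have e4 := boxCount_rotate w (i := i) (j := j) le_rfl le_rfl
  rw [Nat.sub_self] at e3 e4
  simp only [pairRk_zero_left, pairRk_zero_right, pairRk_top_left w x le_rfl,
    pairRk_top_right w x _ le_rfl] at e1 e2
  omega

theorem pairRk_rotate' (w x : Perm (Fin n)) {i j : ℕ} (hi : i ≤ n) (hj : j ≤ n) :
    pairRk (rotate w, rotate x) (i, j) = pairRk (w, x) (n - i, n - j) := by
  rw [← pairRk_rotate w x (Nat.sub_le n i) (Nat.sub_le n j), Nat.sub_sub_self hi,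
    Nat.sub_sub_self hj]

/-- A half turn preserves the ranks of the pair and exchanges above with below and `l` with `r`,
which reduces this to `exists_two_above`. -/
theorem exists_two_below {w x : Perm (Fin n)} {b l j r : ℕ}
    (hnn : ∀ p, 0 ≤ pairRk (w, x) p) (hb : b ≤ n) (hlj : l < j) (hjr : j < r) (hrn : r ≤ n)
    (hr : pairRk (w, x) (b, r) = 0) (hpos : ∀ c, l < c → c < r → 0 < pairRk (w, x) (b, c))
    (hj : pairRk (w, x) (b, j) = 1)
    (hbelow : ∀ k, b < k → k ≤ n → pairRk (w, x) (k, r) = 0 → 0 < boxCount w b k j r)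
    (hstuck : ∀ u v : Fin n, u < v → b ≤ u → l ≤ x u → x u < x v → x v < r →
      ∃ k c : ℕ, ((u : ℕ) < k ∧ k ≤ v) ∧ ((x u : ℕ) < c ∧ c ≤ x v) ∧ pairRk (w, x) (k, c) = 0) :
    ∃ u v : Fin n, u ≠ v ∧ ∀ z, z = u ∨ z = v → b ≤ z ∧ j ≤ x z ∧ x z < r ∧
      ∀ k c : ℕ, b ≤ k → k ≤ z → l < c → c ≤ x z → 0 < pairRk (w, x) (k, c) := by
  have hnn' (p : ℕ × ℕ) : 0 ≤ pairRk (rotate w, rotate x) p := by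
    obtain ⟨i, j⟩ := p
    rcases le_total n i with hi | hi
    · rw [pairRk_top_left _ _ hi]
    rcases le_total n j with hj | hj
    · rw [pairRk_top_right _ _ _ hj]
    rw [pairRk_rotate' w x hi hj]
    exact hnn _
  obtain ⟨u, v, huv, h⟩ := exists_two_above (w := rotate w) (x := rotate x) (a := n - b)
    (l := n - r) (j := n - j) (r := n - l) hnn' (by omega) (by omega)
    (by rw [pairRk_rotate w x hb hrn, hr])
    (fun c h1 h2 => by
      rw [pairRk_rotate' w x (by omega) (by omega), Nat.sub_sub_self hb]
      exact hpos _ (by omega) (by omega))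
    (by rw [pairRk_rotate w x hb (by omega), hj])
    (fun k h1 h2 => by
      rw [pairRk_rotate' w x (by omega) (by omega), Nat.sub_sub_self hrn] at h2
      have := hbelow (n - k) (by omega) (by omega) h2
      rwa [← boxCount_rotate w (by omega) hrn, Nat.sub_sub_self (by omega)] at this)
    (fun u v h1 h2 h3 h4 h5 => by
      simp only [rotate_apply, Fin.val_rev, Fin.rev_lt_rev] at h3 h4 h5
      have hu := (x u.rev).2
      have hv := (x v.rev).2
      have h1' : (u : ℕ) < v := h1
      have hvn := v.2
      have h4' : (x v.rev : ℕ) < x u.rev := h4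
      obtain ⟨k, c, ⟨q1, q2⟩, ⟨q3, q4⟩, q5⟩ := hstuck v.rev u.rev (Fin.rev_lt_rev.2 h1)
        (by rw [Fin.val_rev]; omega) (by omega) h4 (by omega)
      rw [Fin.val_rev] at q1 q2
      refine ⟨n - k, n - c, ⟨by omega, by omega⟩, ?_, ?_⟩
      · simp only [rotate_apply, Fin.val_rev]
        omega
      · rw [pairRk_rotate w x (by omega) (by omega), q5])
  refine ⟨u.rev, v.rev, Fin.rev_injective.ne huv, fun z hz => ?_⟩
  obtain ⟨h1, h2, h3, h4⟩ := h z.rev (by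
    rcases hz with rfl | rfl
    · exact Or.inl (Fin.rev_rev u)
    · exact Or.inr (Fin.rev_rev v))
  simp only [rotate_apply, Fin.rev_rev, Fin.val_rev] at h1 h2 h3 h4
  have hz := z.2
  have hxz := (x z).2
  refine ⟨by omega, by omega, by omega, fun k c q1 q2 q3 q4 => ?_⟩
  have := h4 (n - k) (n - c) (by omega) (by omega) (by omega) (by omega)
  rwa [pairRk_rotate w x (by omega) (by omega)] at this

/-- The statement for all `y` in `[x, w]` permits induction towards longer `y`: any admissible swap
that keeps the configuration gives a contradiction, so the remaining `y` is stuck. -/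
theorem Pinched.not_of_isSmooth {w x y : Perm (Fin n)} (hs : IsSmooth (w, x)) {a b l j r : ℕ}
    (hxy : RankLE x y) (hle : RankLE y w) : ¬Pinched w y a b l j r := by
  intro h
  induction hm : Fintype.card (Fin n × Fin n) - length y using Nat.strong_induction_on
    generalizing y with
  | _ m ih =>
    have hmove (u v : Fin n) (h1 : u < v) (h2 : y u < y v) (h3 : RankLE (y * swap u v) w)
        (h4 : Pinched w (y * swap u v) a b l j r) : False := by
      have hlt := length_lt_length_mul_swap h1 h2
      have := length_le (y * swap u v)
      exact ih _ (by omega) (hxy.trans (rankLE_mul_swap h1 h2)) h3 h4 rfl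
    have hnn := hle.pairRk_nonneg
    have hab := h.hab
    have hlj := h.hlj
    have hjr := h.hjr
    have hj := h.pos j hlj hjr
    rcases lt_or_ge 1 (pairRk (w, y) (a, j)) with h2 | h2
    · obtain ⟨u, v, q1, q2, q3, q4⟩ := h.exists_mul_swap_of_two_le hle h2
      exact hmove u v q1 q2 q3 q4
    have hstuck (u v : Fin n) (h1 : u < v) (h2 : (v : ℕ) < a ∨ b ≤ u) (h3 : l ≤ y u)
        (h4 : y u < y v) (h5 : y v < r) : ∃ k c : ℕ, ((u : ℕ) < k ∧ k ≤ v) ∧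
          ((y u : ℕ) < c ∧ c ≤ y v) ∧ pairRk (w, y) (k, c) = 0 := by
      by_contra! hc
      have h1' : (u : ℕ) < v := h1
      refine hmove u v h1 h4 ((rankLE_mul_swap_iff hle h1 h4).2 fun k c q1 q2 q3 q4 =>
        lt_of_le_of_ne (hnn _) (hc k c ⟨q1, q2⟩ ⟨q3, q4⟩).symm)
        (h.mul_swap h1 h4 (by omega) (by omega) h3 h5 (by omega))
    obtain ⟨A, A', hA, hA1⟩ := exists_two_above hnn hlj hjr h.zero_left h.pos (by omega) h.above
      fun u v q1 q2 => hstuck u v q1 (Or.inl q2)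
    obtain ⟨D, D', hD, hD1⟩ := exists_two_below hnn h.hbn hlj hjr h.hrn
      ((h.same r (by omega) le_rfl).trans h.zero_right)
      (fun c q1 q2 => (h.pos c q1 q2).trans_eq (h.same c q1.le q2.le).symm)
      ((h.same j hlj.le hjr.le).trans (by omega)) h.below
      fun u v q1 q2 => hstuck u v q1 (Or.inr q2)
    have hup (u v : Fin n) (hu : u = A ∨ u = A') (hv : v = D ∨ v = D') :
        u < v ∧ y u < y v ∧ RankLE (y * swap u v) w := by
      obtain ⟨u1, u2, u3, u4⟩ := hA1 u hu
      obtain ⟨v1, v2, v3, v4⟩ := hD1 v hv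
      have q1 : u < v := show (u : ℕ) < v by omega
      have q2 : y u < y v := show (y u : ℕ) < y v by omega
      refine ⟨q1, q2, (rankLE_mul_swap_iff hle q1 q2).2 fun k c g1 g2 g3 g4 => ?_⟩
      -- Up to row `a` the rectangle lies in the corner of `u`, from row `b` on in that of `v`; in
      -- between, `Pinched.mid` carries over the positivity of row `a`.
      rcases le_or_gt k a with hk | hk
      · exact u4 k c g1 hk g3 (by omega)
      rcases le_or_gt b k with hk' | hk'
      · exact v4 k c hk' g2 (by omega) g4
      · have := h.mid hk.le hk'.le (show l ≤ c by omega) (by omega)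
        have := h.pos c (by omega) (by omega)
        have := hnn (k, l)
        omega
    obtain ⟨u1, u2, u3⟩ := hup A D (Or.inl rfl) (Or.inl rfl)
    obtain ⟨v1, v2, v3⟩ := hup A' D' (Or.inr rfl) (Or.inr rfl)
    obtain ⟨a1, a2, a3, -⟩ := hA1 A (Or.inl rfl)
    obtain ⟨a1', a2', a3', -⟩ := hA1 A' (Or.inr rfl)
    obtain ⟨d1, d2, d3, -⟩ := hD1 D (Or.inl rfl)
    obtain ⟨d1', d2', d3', -⟩ := hD1 D' (Or.inr rfl)
    have hDA' : D' ≠ A := by rintro rfl; omega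
    have hA'D : A' ≠ D := by rintro rfl; omega
    -- The point `(a, j)` lies in both rectangles, so its rank 1 would fall to `-1`.
    have hfin := (hs.rankLE_mul_swap_mul_swap hxy u1 u2 u3 v1.ne hA.symm hA'D hDA' hD.symm
      v3).pairRk_nonneg (a, j)
    have e1 : (y * swap A D) A' = y A' := by
      rw [Perm.mul_apply, swap_apply_of_ne_of_ne hA.symm hA'D]
    have e2 : (y * swap A D) D' = y D' := by
      rw [Perm.mul_apply, swap_apply_of_ne_of_ne hDA' hD.symm]
    rw [pairRk_mul_swap w _ v1 (by rwa [e1, e2]), pairRk_mul_swap w y u1 u2, e1, e2,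
      if_pos (by omega), if_pos (by omega)] at hfin
    omega

/-! ### From failed conditions to a pinched configuration -/

/-- The data of `next↓(i, j) = (i', j)`, with auxiliary column `r`, when `P↓` fails at `(i, j)`. -/
structure StuckDown (w x : Perm (Fin n)) (i i' j r : ℕ) : Prop where
  le : i ≤ i'
  le_n : i' ≤ n
  lt : j < r
  col_le : r ≤ n
  zero : pairRk (w, x) (i, r) = 0
  pos : ∀ c, j ≤ c → c < r → 0 < pairRk (w, x) (i, c)
  same : ∀ c, j ≤ c → c ≤ r → pairRk (w, x) (i', c) = pairRk (w, x) (i, c)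
  empty : boxCount x i i' j r = 0
  empty' : boxCount w i i' j r = 0
  below : ∀ k, i' < k → k ≤ n → pairRk (w, x) (k, r) = 0 → 0 < boxCount w i' k j r

/-- The data of `next↑(i, j) = (i', j)`, with auxiliary column `l`, when `P↑` fails at `(i, j)`. -/
structure StuckUp (w x : Perm (Fin n)) (i i' j l : ℕ) : Prop where
  le : i' ≤ i
  lt : l < j
  zero : pairRk (w, x) (i, l) = 0
  pos : ∀ c, l < c → c ≤ j → 0 < pairRk (w, x) (i, c)
  same : ∀ c, l ≤ c → c ≤ j → pairRk (w, x) (i', c) = pairRk (w, x) (i, c)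
  empty : boxCount x i' i l j = 0
  empty' : boxCount w i' i l j = 0
  above : ∀ k < i', pairRk (w, x) (k, l) = 0 → 0 < boxCount w k i' l j

variable {w x : Perm (Fin n)}

theorem diff_eq_boxCount (w : Perm (Fin n)) {i i' j j' : ℕ} (hi : i ≤ i') (hj : j ≤ j') :
    diff w (i, j) (i', j') = boxCount w i i' j j' := by
  rw [boxCount_eq w hi hj]
  simp only [diff]
  ring

theorem diff_comm (w : Perm (Fin n)) (p q : ℕ × ℕ) : diff w p q = diff w q p := by
  simp only [diff]
  ring

theorem exists_stuckDown (hle : RankLE x w) {i j : ℕ} (hi : i ≤ n)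
    (hpos : 0 < pairRk (w, x) (i, j)) (hP : ¬PDown (w, x) (i, j)) :
    ∃ i' r, nextDown (w, x) (i, j) = (i', j) ∧ StuckDown w x i i' j r := by
  have hnn := hle.pairRk_nonneg
  have hjn : j < n := by
    by_contra hc
    rw [pairRk_top_right w x i (not_lt.1 hc)] at hpos
    omega
  have hr : colRight (w, x) (i, j) ∈ {k | j < k ∧ (i, k) ∈ levelSet (w, x)} :=
    Nat.sInf_mem ⟨n, hjn, ⟨hi, le_rfl⟩, pairRk_top_right w x i le_rfl⟩
  have hrmin (k : ℕ) (h1 : j < k) (h2 : k < colRight (w, x) (i, j)) :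
      (i, k) ∉ levelSet (w, x) := fun h3 => Nat.notMem_of_lt_sInf h2 ⟨h1, h3⟩
  have hdef : nextDown (w, x) (i, j) = (sSup {l | i ≤ l ∧
    (l, colRight (w, x) (i, j)) ∈ levelSet (w, x) ∧
      diff w (i, j) (l, colRight (w, x) (i, j)) = 0}, j) := rfl
  generalize colRight (w, x) (i, j) = r at hr hrmin hdef
  obtain ⟨hjr, ⟨-, hrn⟩, hz⟩ := hr
  simp only at hrn
  have hbdd : BddAbove {l | i ≤ l ∧ (l, r) ∈ levelSet (w, x) ∧ diff w (i, j) (l, r) = 0} :=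
    ⟨n, fun l hl => hl.2.1.1.1⟩
  have hmem := Nat.sSup_mem (s := {l | i ≤ l ∧ (l, r) ∈ levelSet (w, x) ∧
    diff w (i, j) (l, r) = 0}) ⟨i, le_rfl, ⟨⟨hi, hrn⟩, hz⟩, by simp [diff]⟩ hbdd
  have hmax (l : ℕ) (h1 : i ≤ l) (h2 : l ≤ n) (h3 : pairRk (w, x) (l, r) = 0)
      (h4 : diff w (i, j) (l, r) = 0) := le_csSup hbdd ⟨h1, ⟨⟨h2, hrn⟩, h3⟩, h4⟩
  unfold PDown at hP
  rw [hdef] at hP ⊢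
  generalize sSup {l | i ≤ l ∧ (l, r) ∈ levelSet (w, x) ∧ diff w (i, j) (l, r) = 0} = i'
    at hmem hmax hP
  obtain ⟨hii, ⟨⟨hin, -⟩, hz'⟩, hd⟩ := hmem
  simp only at hin
  rw [diff_eq_boxCount w hii hjr.le] at hd
  have hwe : boxCount w i i' j r = 0 := by exact_mod_cast hd
  -- Both rows have rank zero at column `r` and `w` has no points in the box, so the rank at column
  -- `j` drops by the number of points of `x`. Failure of `P↓` makes this number zero.
  have hxe : boxCount x i i' j r = 0 := by
    have e := pairRk_box w x hii hjr.le
    omega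
  refine ⟨i', r, rfl, hii, hin, hjr, hrn, hz, fun c h1 h2 => ?_, fun c h1 h2 => ?_, hxe, hwe,
    fun k h1 h2 h3 => ?_⟩
  · rcases h1.eq_or_lt with rfl | h1
    · exact hpos
    · exact lt_of_le_of_ne (hnn _) fun h => hrmin c h1 h2 ⟨⟨hi, by simp only; omega⟩, h.symm⟩
  · have e := pairRk_box w x hii h2
    have := boxCount_mono x (le_refl i) (le_refl i') h1 (le_refl r)
    have := boxCount_mono w (le_refl i) (le_refl i') h1 (le_refl r)
    omega
  -- If no point of `w` were passed, row `k` would also qualify for `next↓`, against the maximality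
  -- of `i'`.
  · by_contra hc
    have hik : i ≤ k := by omega
    refine absurd (hmax k hik h2 h3 ?_) (not_le.2 h1)
    have e1 := boxCount_eq w hii hjr.le
    have e2 := boxCount_eq w h1.le hjr.le
    have e3 := boxCount_eq w hik hjr.le
    rw [diff_eq_boxCount w hik hjr.le]
    omega

theorem exists_stuckUp (hle : RankLE x w) {i j : ℕ} (hi : i ≤ n) (hj : j ≤ n)
    (hpos : 0 < pairRk (w, x) (i, j)) (hP : ¬PUp (w, x) (i, j)) :
    ∃ i' l, nextUp (w, x) (i, j) = (i', j) ∧ StuckUp w x i i' j l := by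
  have hnn := hle.pairRk_nonneg
  have hj0 : 0 < j := by
    rcases Nat.eq_zero_or_pos j with rfl | h
    · rw [pairRk_zero_right] at hpos
      omega
    · exact h
  have hbdd : BddAbove {k | k < j ∧ (i, k) ∈ levelSet (w, x)} := ⟨j, fun k hk => hk.1.le⟩
  have hl : colLeft (w, x) (i, j) ∈ {k | k < j ∧ (i, k) ∈ levelSet (w, x)} :=
    Nat.sSup_mem ⟨0, hj0, ⟨hi, Nat.zero_le n⟩, pairRk_zero_right w x i⟩ hbdd
  have hlmax (k : ℕ) (h1 : k < j) (h2 : colLeft (w, x) (i, j) < k) :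
      (i, k) ∉ levelSet (w, x) := fun h3 => absurd (le_csSup hbdd ⟨h1, h3⟩) (not_le.2 h2)
  have hdef : nextUp (w, x) (i, j) = (sInf {k | k ≤ i ∧
    (k, colLeft (w, x) (i, j)) ∈ levelSet (w, x) ∧
      diff w (i, j) (k, colLeft (w, x) (i, j)) = 0}, j) := rfl
  generalize colLeft (w, x) (i, j) = l at hl hlmax hdef
  obtain ⟨hlj, ⟨-, hln⟩, hz⟩ := hl
  simp only at hln
  have hmem := Nat.sInf_mem (s := {k | k ≤ i ∧ (k, l) ∈ levelSet (w, x) ∧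
    diff w (i, j) (k, l) = 0}) ⟨i, le_rfl, ⟨⟨hi, hln⟩, hz⟩, by simp [diff]⟩
  have hmin (k : ℕ) (h1 : k ≤ i) (h3 : pairRk (w, x) (k, l) = 0)
      (h4 : diff w (i, j) (k, l) = 0) :=
    Nat.sInf_le (s := {k | k ≤ i ∧ (k, l) ∈ levelSet (w, x) ∧ diff w (i, j) (k, l) = 0})
      ⟨h1, ⟨⟨h1.trans hi, hln⟩, h3⟩, h4⟩
  unfold PUp at hP
  rw [hdef] at hP ⊢
  generalize sInf {k | k ≤ i ∧ (k, l) ∈ levelSet (w, x) ∧ diff w (i, j) (k, l) = 0} = i'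
    at hmem hmin hP
  obtain ⟨hii, ⟨-, hz'⟩, hd⟩ := hmem
  rw [diff_comm, diff_eq_boxCount w hii hlj.le] at hd
  have hwe : boxCount w i' i l j = 0 := by exact_mod_cast hd
  have hxe : boxCount x i' i l j = 0 := by
    have e := pairRk_box w x hii hlj.le
    omega
  refine ⟨i', l, rfl, hii, hlj, hz, fun c h1 h2 => ?_, fun c h1 h2 => ?_, hxe, hwe,
    fun k h1 h3 => ?_⟩
  · rcases h2.eq_or_lt with rfl | h2
    · exact hpos
    · exact lt_of_le_of_ne (hnn _) fun h => hlmax c h2 h1 ⟨⟨hi, by simp only; omega⟩, h.symm⟩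
  · have e := pairRk_box w x hii h1
    have := boxCount_mono x (le_refl i') (le_refl i) (le_refl l) h2
    have := boxCount_mono w (le_refl i') (le_refl i) (le_refl l) h2
    omega
  · by_contra hc
    have hik : k ≤ i := by omega
    refine absurd (hmin k hik h3 ?_) (not_le.2 h1)
    have e1 := boxCount_eq w hii hlj.le
    have e2 := boxCount_eq w h1.le hlj.le
    have e3 := boxCount_eq w hik hlj.le
    rw [diff_comm, diff_eq_boxCount w hik hlj.le]
    omega

theorem boxCount_add_row (y : Perm (Fin n)) {i k i' j j' : ℕ} (h1 : i ≤ k) (h2 : k ≤ i')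
    (hj : j ≤ j') : boxCount y i i' j j' = boxCount y i k j j' + boxCount y k i' j j' := by
  have e1 := boxCount_eq y h1 hj
  have e2 := boxCount_eq y h2 hj
  have e3 := boxCount_eq y (h1.trans h2) hj
  omega

theorem boxCount_add_col (y : Perm (Fin n)) {i i' j k j' : ℕ} (hi : i ≤ i') (h1 : j ≤ k)
    (h2 : k ≤ j') : boxCount y i i' j j' = boxCount y i i' j k + boxCount y i i' k j' := by
  have e1 := boxCount_eq y hi h1
  have e2 := boxCount_eq y hi h2
  have e3 := boxCount_eq y hi (h1.trans h2)
  omega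

/-- Going down from `(i, j)` and then up by not more than before gives a pinched
configuration. -/
theorem StuckDown.pinched {i b a j r l : ℕ} (hd : StuckDown w x i b j r)
    (hu : StuckUp w x b a j l) (hia : i ≤ a) : Pinched w x a b l j r := by
  have hle := hu.le
  have hlj := hu.lt
  have hjr := hd.lt
  have ex := boxCount_add_row x hia hle hjr.le
  have ew := boxCount_add_row w hia hle hjr.le
  have exc := boxCount_add_col x hle hlj.le hjr.le
  have ewc := boxCount_add_col w hle hlj.le hjr.le
  have hx := hd.empty
  have hw := hd.empty'
  have hx' := hu.empty
  have hw' := hu.empty'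
  have hrow (c : ℕ) (h1 : j ≤ c) (h2 : c ≤ r) :
      pairRk (w, x) (b, c) = pairRk (w, x) (a, c) := by
    have e := pairRk_box w x hle h1
    have := boxCount_mono x (le_refl a) (le_refl b) (le_refl j) h2
    have := boxCount_mono w (le_refl a) (le_refl b) (le_refl j) h2
    have := hu.same j hlj.le le_rfl
    omega
  have hsame (c : ℕ) (h1 : l ≤ c) (h2 : c ≤ r) :
      pairRk (w, x) (b, c) = pairRk (w, x) (a, c) := by
    rcases le_total c j with hc | hc
    · exact (hu.same c h1 hc).symm
    · exact hrow c hc h2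
  refine ⟨hle, hd.le_n, hlj, hjr, hd.col_le, ?_, ?_, fun c h1 h2 => ?_, hsame, by omega, by omega,
    hu.above, hd.below⟩
  · rw [hu.same l le_rfl hlj.le, hu.zero]
  · rw [← hsame r (by omega) le_rfl, hd.same r hjr.le le_rfl, hd.zero]
  · rw [← hsame c h1.le h2.le]
    rcases le_total c j with hc | hc
    · exact hu.pos c h1 hc
    · rw [hd.same c hc h2.le]
      exact hd.pos c hc h2

/-- Going up from `(i, j)` and then down by not more than before gives a pinched
configuration. -/
theorem StuckUp.pinched {i b a j r l : ℕ} (hu : StuckUp w x i a j l)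
    (hd : StuckDown w x a b j r) (hbi : b ≤ i) : Pinched w x a b l j r := by
  have hle := hd.le
  have hlj := hu.lt
  have hjr := hd.lt
  have ex := boxCount_add_row x hle hbi hlj.le
  have ew := boxCount_add_row w hle hbi hlj.le
  have exc := boxCount_add_col x hle hlj.le hjr.le
  have ewc := boxCount_add_col w hle hlj.le hjr.le
  have hx := hd.empty
  have hw := hd.empty'
  have hx' := hu.empty
  have hw' := hu.empty'
  have hsame (c : ℕ) (h1 : l ≤ c) (h2 : c ≤ r) :
      pairRk (w, x) (b, c) = pairRk (w, x) (a, c) := by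
    rcases le_total j c with hc | hc
    · exact hd.same c hc h2
    · have e := pairRk_box w x hle hc
      have := boxCount_mono x (le_refl a) (le_refl b) h1 (le_refl j)
      have := boxCount_mono w (le_refl a) (le_refl b) h1 (le_refl j)
      have := hd.same j le_rfl hjr.le
      omega
  refine ⟨hle, hd.le_n, hlj, hjr, hd.col_le, ?_, hd.zero, fun c h1 h2 => ?_, hsame, by omega,
    by omega, hu.above, hd.below⟩
  · rw [hu.same l le_rfl hlj.le, hu.zero]
  · rcases le_total j c with hc | hc
    · exact hd.pos c hc h2
    · rw [hu.same c h1.le hc]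
      exact hu.pos c h1 hc

/-- If going down and then up passes the starting row, and so does going up and then down, then
the rows reached in one step span a pinched configuration. -/
theorem pinched_of_cross {i a b a' b' j l r l' r' : ℕ} (hd : StuckDown w x i b j r)
    (hu : StuckUp w x i a j l) (hdu : StuckUp w x b a' j l') (hud : StuckDown w x a b' j r')
    (ha' : a' ≤ i) (hb' : i ≤ b') : Pinched w x a b l j r := by
  have hai := hu.le
  have hib := hd.le
  have hlj := hu.lt
  have hjr := hd.lt
  have hlj' := hdu.lt
  have hjr' := hud.lt
  -- Since `i ≤ b'`, the rows from `a` to `i` belong to the empty box of `hud`, and rows `i` and `a`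
  -- agree up to column `r'`.
  have hr (c : ℕ) (h1 : j ≤ c) (h2 : c ≤ r') :
      pairRk (w, x) (i, c) = pairRk (w, x) (a, c) := by
    have e := pairRk_box w x hai h1
    have := boxCount_mono x (le_refl a) hb' (le_refl j) h2
    have := boxCount_mono w (le_refl a) hb' (le_refl j) h2
    have := hud.empty
    have := hud.empty'
    have := hu.same j hlj.le le_rfl
    omega
  have hl (c : ℕ) (h1 : l' ≤ c) (h2 : c ≤ j) :
      pairRk (w, x) (i, c) = pairRk (w, x) (b, c) := by
    have e := pairRk_box w x hib h2
    have := boxCount_mono x ha' (le_refl b) h1 (le_refl j)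
    have := boxCount_mono w ha' (le_refl b) h1 (le_refl j)
    have := hdu.empty
    have := hdu.empty'
    have := hd.same j le_rfl hjr.le
    omega
  -- Both are the first zero after `j`, in row `a` and in row `i`, and these rows agree.
  obtain rfl : r' = r := by
    rcases lt_trichotomy r' r with h | h | h
    · have := hd.pos r' hjr'.le h
      have := hr r' hjr'.le le_rfl
      have := hud.zero
      omega
    · exact h
    · have := hud.pos r hjr.le h
      have := hr r hjr.le h.le
      have := hd.zero
      omega
  obtain rfl : l' = l := by
    rcases lt_trichotomy l' l with h | h | h
    · have := hdu.pos l h hlj.le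
      have := hl l h.le hlj.le
      have := hu.zero
      omega
    · exact h
    · have := hu.pos l' h hlj'.le
      have := hl l' le_rfl hlj'.le
      have := hdu.zero
      omega
  have hbox (y : Perm (Fin n)) (h1 : boxCount y i b j r' = 0) (h2 : boxCount y a i l' j = 0)
      (h3 : boxCount y a' b l' j = 0) (h4 : boxCount y a b' j r' = 0) :
      boxCount y a b l' r' = 0 := by
    have e1 := boxCount_add_row y hai hib (hlj.trans hjr).le
    have e2 := boxCount_add_col y hai hlj.le hjr.le
    have e3 := boxCount_add_col y hib hlj.le hjr.le
    have e4 := boxCount_mono y (le_refl a) hb' (le_refl j) (le_refl r')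
    have e5 := boxCount_mono y ha' (le_refl b) (le_refl l') (le_refl j)
    omega
  refine ⟨hai.trans hib, hd.le_n, hlj, hjr, hd.col_le, ?_, hud.zero, fun c h1 h2 => ?_,
    fun c h1 h2 => ?_, hbox x hd.empty hu.empty hdu.empty hud.empty,
    hbox w hd.empty' hu.empty' hdu.empty' hud.empty', hu.above, hd.below⟩
  · rw [hu.same _ le_rfl hlj.le, hu.zero]
  · rcases le_total j c with hc | hc
    · exact hud.pos c hc h2
    · rw [hu.same c h1.le hc]
      exact hu.pos c h1 hc
  · rcases le_total j c with hc | hc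
    · rw [hd.same c hc h2, hr c hc h2]
    · rw [hu.same c h1 hc, hl c h1 hc]

end LevelSet


theorem proposition2p7 (n : ℕ) (π : Equiv.Perm (Fin n) × Equiv.Perm (Fin n))
    (hπ : π ∈ LevelSet.pairs n) (hsmooth : LevelSet.IsSmooth π)
    (p : ℕ × ℕ) (hp : p ∈ LevelSet.levelCompl π) :
    LevelSet.Q π p := by
  obtain ⟨w, x⟩ := π
  obtain ⟨i, j⟩ := p
  obtain ⟨⟨hi, hj⟩, hpos⟩ := hp
  have hle : LevelSet.RankLE x w := LevelSet.BruhatLE.rankLE hπ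
  have hno {a b l r : ℕ} : ¬LevelSet.Pinched w x a b l j r :=
    LevelSet.Pinched.not_of_isSmooth hsmooth (LevelSet.RankLE.refl x) hle
  by_contra hQ
  simp only [LevelSet.Q, not_or] at hQ
  obtain ⟨h1, h2, h3, h4⟩ := hQ
  obtain ⟨b, r, hb, hd⟩ := LevelSet.exists_stuckDown hle hi hpos h1
  obtain ⟨a, l, ha, hu⟩ := LevelSet.exists_stuckUp hle hi hj hpos h2
  rw [hb] at h3
  rw [ha] at h4
  obtain ⟨a', l', -, hdu⟩ := LevelSet.exists_stuckUp hle hd.le_n hj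
    (hpos.trans_eq (hd.same j le_rfl hd.lt.le).symm) h3
  obtain ⟨b', r', -, hud⟩ := LevelSet.exists_stuckDown hle (hu.le.trans hi)
    (hpos.trans_eq (hu.same j hu.lt.le le_rfl).symm) h4
  -- A second step that does not pass row `i` pinches with the first one; otherwise both second
  -- steps reach `i` or pass it, and the two first steps together span the configuration.
  rcases le_total i a' with ha' | ha'
  · exact hno (hd.pinched hdu ha')
  rcases le_total b' i with hb' | hb'
  · exact hno (hu.pinched hud hb')
  exact hno (LevelSet.pinched_of_cross hd hu hdu hud ha' hb')
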